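/- Let $\rho:(0,\infty)\to[0,\infty)$ be the radial profile of the degree-one vortex on the hyperbolic plane with metric $2\,dr^2+2\sinh^2 r\,d\theta^2$, i.e. the smooth solution of $$\tfrac12\rho''+\tfrac12\coth(r)\,\rho'-\frac{1}{2\sinh^2 r}\,\rho+\rho-\rho^3=0\quad(r>0),\qquad \lim_{r\to0}\rho(r)=0,\quad \lim_{r\to\infty}\rho(r)=1,\quad \rho\ge 0 .$$ In $L^2((0,\infty),dr)$ (complex-valued functions) let $$\mathfrak L_0=-\tfrac12\partial_r^2+\frac{3}{8\sinh^2 r}+\tfrac18,\qquad \mathfrak L_1=\mathfrak L_0+\rho^2-1,\qquad \mathfrak L_2=\mathfrak L_0+3\rho^2-1,$$ each with the domain $\mathcal D=\{f\in L^2(0,\infty): \mathfrak L_0 f\in L^2(0,\infty)\}$, and let $$\mathcal L_{GP}=\begin{pmatrix}0&\mathfrak L_1\\-\mathfrak L_2&0\end{pmatrix}\quad\text{in } L^2(0,\infty)\times L^2(0,\infty)\text{ with domain }\mathcal D\times\mathcal D .$$ Then $i\mathcal L_{GP}$ has no eigenvalues in $\left(-\infty,-\tfrac{\sqrt{17}}8\right]\cup\left[\tfrac{\sqrt{17}}8,\infty\right)$: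 for real $\lambda$ with $|\lambda|\ge\tfrac{\sqrt{17}}8$, the only $\Phi\in\mathcal D\times\mathcal D$ with $i\mathcal L_{GP}\Phi=\lambda\Phi$ is $\Phi=0$. -/

import Mathlib

open MeasureTheory Set Filter Topology

noncomputable section

namespace GrossPitaevskii

/-- Lebesgue measure `dr` on the half-line `(0, ∞)`. -/
abbrev halfLine : Measure ℝ := volume.restrict (Ioi (0 : ℝ))

/-- The complex Hilbert space `L²((0, ∞), dr)`. -/
abbrev L2 : Type := Lp ℂ 2 halfLine

/-- `ρ` is the radial profile of the degree-one vortex `ρ(r) e^{iθ}` on the hyperbolic plane with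
metric `2 dr² + 2 sinh² r dθ²`: a smooth nonnegative solution on `(0, ∞)` of
`½ρ'' + ½ coth(r) ρ' - ρ / (2 sinh² r) + ρ - ρ³ = 0` with `ρ → 0` at `0` and `ρ → 1` at `∞`.
The values of `ρ` on `(-∞, 0]` play no role. -/
structure IsVortexProfile (ρ : ℝ → ℝ) : Prop where
  smooth : ContDiffOn ℝ (⊤ : ℕ∞) ρ (Ioi 0)
  ode : ∀ r : ℝ, 0 < r →
    1 / 2 * deriv (deriv ρ) r + 1 / 2 * (Real.cosh r / Real.sinh r) * deriv ρ r
      - 1 / (2 * Real.sinh r ^ 2) * ρ r + ρ r - ρ r ^ 3 = 0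
  nonneg : ∀ r : ℝ, 0 < r → 0 ≤ ρ r
  tendsto_zero : Tendsto ρ (𝓝[>] 0) (𝓝 0)
  tendsto_one : Tendsto ρ atTop (𝓝 1)

/-- On `(0, ∞)`: `u` is `C¹` with derivative `u₁`, and `u₁` is locally absolutely continuous with
almost everywhere derivative `u₂`, expressed by `u₂ ∈ L¹_loc(0, ∞)` and the fundamental theorem of
calculus. Equivalently, `u₂` is the second distributional derivative of `u` on `(0, ∞)`, with `u`
the continuous representative. -/
structure HasSecondDeriv (u u₁ u₂ : ℝ → ℂ) : Prop where
  hasDerivAt : ∀ r : ℝ, 0 < r → HasDerivAt u (u₁ r) r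
  intervalIntegrable : ∀ a b : ℝ, 0 < a → 0 < b → IntervalIntegrable u₂ volume a b
  integral_eq : ∀ a b : ℝ, 0 < a → 0 < b → ∫ r in a..b, u₂ r = u₁ b - u₁ a

theorem HasSecondDeriv.add {u u₁ u₂ v v₁ v₂ : ℝ → ℂ} (hu : HasSecondDeriv u u₁ u₂)
    (hv : HasSecondDeriv v v₁ v₂) : HasSecondDeriv (u + v) (u₁ + v₁) (u₂ + v₂) where
  hasDerivAt r hr := (hu.hasDerivAt r hr).add (hv.hasDerivAt r hr)
  intervalIntegrable a b ha hb :=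
    (hu.intervalIntegrable a b ha hb).add (hv.intervalIntegrable a b ha hb)
  integral_eq a b ha hb := by
    have h := intervalIntegral.integral_add (hu.intervalIntegrable a b ha hb)
      (hv.intervalIntegrable a b ha hb)
    simp only [Pi.add_apply]
    rw [h, hu.integral_eq a b ha hb, hv.integral_eq a b ha hb]
    ring

theorem HasSecondDeriv.smul {u u₁ u₂ : ℝ → ℂ} (c : ℂ) (hu : HasSecondDeriv u u₁ u₂) :
    HasSecondDeriv (c • u) (c • u₁) (c • u₂) where
  hasDerivAt r hr := (hu.hasDerivAt r hr).const_smul c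
  intervalIntegrable a b ha hb := (hu.intervalIntegrable a b ha hb).smul c
  integral_eq a b ha hb := by
    simp only [Pi.smul_apply, intervalIntegral.integral_smul, hu.integral_eq a b ha hb, smul_sub]

/-- A vanishing function has vanishing second derivative. -/
theorem HasSecondDeriv.ae_eq_zero {u u₁ u₂ : ℝ → ℂ} (hu : HasSecondDeriv u u₁ u₂)
    (h0 : u =ᵐ[halfLine] 0) : (∀ r : ℝ, 0 < r → u r = 0) ∧ u₂ =ᵐ[halfLine] 0 := by
  have hc : ContinuousOn u (Ioi 0) := fun r hr =>
    (hu.hasDerivAt r hr).continuousAt.continuousWithinAt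
  have h : EqOn u 0 (Ioi 0) :=
    Measure.eqOn_open_of_ae_eq h0 isOpen_Ioi hc continuousOn_const
  have h1 : ∀ r : ℝ, 0 < r → u₁ r = 0 := by
    intro r hr
    have he : u =ᶠ[𝓝 r] fun _ => (0 : ℂ) := by
      filter_upwards [isOpen_Ioi.mem_nhds hr] with x hx using h hx
    exact ((hasDerivAt_const r (0 : ℂ)).congr_of_eventuallyEq he).unique (hu.hasDerivAt r hr) |>.symm
  have h2 : ∀ n : ℕ, ∀ᵐ r : ℝ, r ∈ Ioo (1 / ((n : ℝ) + 1)) ((n : ℝ) + 1) → u₂ r = 0 := by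
    intro n
    have hn : (0 : ℝ) < (n : ℝ) + 1 := by positivity
    have hn' : (0 : ℝ) < 1 / ((n : ℝ) + 1) := by positivity
    filter_upwards [(hu.intervalIntegrable _ _ hn' hn).ae_hasDerivAt_integral] with r hr hrm
    have hrI : r ∈ uIcc (1 / ((n : ℝ) + 1)) ((n : ℝ) + 1) := Icc_subset_uIcc (Ioo_subset_Icc_self hrm)
    have hd := hr hrI _ left_mem_uIcc
    have he : (fun x => ∫ t in (1 / ((n : ℝ) + 1))..x, u₂ t) =ᶠ[𝓝 r] fun _ => (0 : ℂ) := by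
      filter_upwards [isOpen_Ioi.mem_nhds (show r ∈ Ioi (0 : ℝ) from hn'.trans hrm.1)] with x hx
      rw [hu.integral_eq _ _ hn' hx, h1 _ hn', h1 _ hx, sub_zero]
    exact (((hasDerivAt_const r (0 : ℂ)).congr_of_eventuallyEq he).unique hd).symm
  refine ⟨fun r hr => h hr, (ae_restrict_iff' measurableSet_Ioi).2 ?_⟩
  filter_upwards [ae_all_iff.2 h2] with r hr hr0
  have hr0' : (0 : ℝ) < r := hr0
  obtain ⟨m, hm⟩ := exists_nat_one_div_lt hr0'
  obtain ⟨k, hk⟩ := exists_nat_gt r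
  refine hr (max m k) ⟨lt_of_le_of_lt ?_ hm, ?_⟩
  · apply one_div_le_one_div_of_le (by positivity)
    have : (m : ℝ) ≤ ((max m k : ℕ) : ℝ) := by exact_mod_cast le_max_left m k
    linarith
  · have : (k : ℝ) ≤ ((max m k : ℕ) : ℝ) := by exact_mod_cast le_max_right m k
    linarith

/-- The graph of the maximal realization in `L²(0, ∞)` of the differential expression
`-½ d²/dr² + W(r)`: all pairs `(f, g)` in `L² × L²` with `g = -½ f'' + W f`. -/
def schrodingerGraph (W : ℝ → ℝ) : Submodule ℂ (L2 × L2) where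
  carrier := {p | ∃ u u₁ u₂ : ℝ → ℂ, HasSecondDeriv u u₁ u₂ ∧ p.1 =ᵐ[halfLine] u ∧
    p.2 =ᵐ[halfLine] fun r => -(1 / 2) * u₂ r + (W r : ℂ) * u r}
  zero_mem' := by
    refine ⟨0, 0, 0, ⟨fun r _ => hasDerivAt_const r 0, fun a b _ _ => ?_, ?_⟩, ?_, ?_⟩
    · exact intervalIntegrable_const (μ := volume) (a := a) (b := b) (c := (0 : ℂ))
    · simp
    · exact Lp.coeFn_zero ℂ 2 halfLine
    · filter_upwards [Lp.coeFn_zero ℂ 2 halfLine] with r hr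
      simpa using hr
  add_mem' := by
    rintro ⟨f, g⟩ ⟨f', g'⟩ ⟨u, u₁, u₂, hu, hf, hg⟩ ⟨v, v₁, v₂, hv, hf', hg'⟩
    refine ⟨u + v, u₁ + v₁, u₂ + v₂, hu.add hv, ?_, ?_⟩
    · filter_upwards [Lp.coeFn_add f f', hf, hf'] with r h1 h2 h3
      simp only [Prod.mk_add_mk, h1, Pi.add_apply, h2, h3]
    · filter_upwards [Lp.coeFn_add g g', hg, hg'] with r h1 h2 h3
      simp only [Prod.mk_add_mk, h1, Pi.add_apply, h2, h3]
      ring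
  smul_mem' := by
    rintro c ⟨f, g⟩ ⟨u, u₁, u₂, hu, hf, hg⟩
    refine ⟨c • u, c • u₁, c • u₂, hu.smul c, ?_, ?_⟩
    · filter_upwards [Lp.coeFn_smul c f, hf] with r h1 h2
      simp only [Prod.smul_mk, h1, Pi.smul_apply, h2]
    · filter_upwards [Lp.coeFn_smul c g, hg] with r h1 h2
      simp only [Prod.smul_mk, h1, Pi.smul_apply, h2, smul_eq_mul]
      ring

/-- `schrodingerGraph W` is the graph of an operator. -/
theorem schrodingerGraph_functional (W : ℝ → ℝ) (p : L2 × L2) (hp : p ∈ schrodingerGraph W)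
    (h0 : p.1 = 0) : p.2 = 0 := by
  obtain ⟨u, u₁, u₂, hu, hf, hg⟩ := hp
  have hu0 : u =ᵐ[halfLine] 0 := by
    rw [h0] at hf
    exact hf.symm.trans (Lp.coeFn_zero ℂ 2 halfLine)
  obtain ⟨-, h2⟩ := hu.ae_eq_zero hu0
  refine Lp.ext ?_
  filter_upwards [hg, hu0, h2, Lp.coeFn_zero ℂ 2 halfLine] with r h1 h3 h4 h5
  rw [h1, h5, h3, h4]
  simp

/-- The operator `-½ d²/dr² + W(r)` in `L²(0, ∞)` with its maximal domain
`{f ∈ L² | -½ f'' + W f ∈ L²}`. -/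
def schrodinger (W : ℝ → ℝ) : L2 →ₗ.[ℂ] L2 := (schrodingerGraph W).toLinearPMap

theorem schrodinger_graph (W : ℝ → ℝ) : (schrodinger W).graph = schrodingerGraph W :=
  Submodule.toLinearPMap_graph_eq _ fun p hp h0 => schrodingerGraph_functional W p hp h0

/-- The potential `3 / (8 sinh² r) + 1/8` of the free operator `𝔏₀`. -/
def freePotential (r : ℝ) : ℝ := 3 / (8 * Real.sinh r ^ 2) + 1 / 8

/-- `𝔏₁ = -½ ∂_r² + 3 / (8 sinh² r) + 1/8 + ρ² - 1`. Since `ρ² - 1` is bounded for a vortex profile,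
the domain is that of `𝔏₀`, namely `{f ∈ L² | 𝔏₀ f ∈ L²}`; likewise for `𝔏₂`. -/
def frakL₁ (ρ : ℝ → ℝ) : L2 →ₗ.[ℂ] L2 := schrodinger fun r => freePotential r + (ρ r ^ 2 - 1)

/-- `𝔏₂ = -½ ∂_r² + 3 / (8 sinh² r) + 1/8 + 3ρ² - 1`. -/
def frakL₂ (ρ : ℝ → ℝ) : L2 →ₗ.[ℂ] L2 := schrodinger fun r => freePotential r + (3 * ρ r ^ 2 - 1)

/-- The block operator `(0, A; -B, 0)`, i.e. `(φ, ψ) ↦ (A ψ, -B φ)`, with domain `D(B) × D(A)`. -/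
def offDiagonal (A B : L2 →ₗ.[ℂ] L2) : (L2 × L2) →ₗ.[ℂ] (L2 × L2) where
  domain := B.domain.prod A.domain
  toFun :=
    { toFun := fun x => (A ⟨x.1.2, x.2.2⟩, -B ⟨x.1.1, x.2.1⟩)
      map_add' := by
        intro x y
        have hA := A.map_add ⟨x.1.2, x.2.2⟩ ⟨y.1.2, y.2.2⟩
        have hB := B.map_add ⟨x.1.1, x.2.1⟩ ⟨y.1.1, y.2.1⟩
        exact Prod.ext hA ((congrArg Neg.neg hB).trans (neg_add _ _))
      map_smul' := by
        intro c x
        have hA := A.map_smul c ⟨x.1.2, x.2.2⟩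
        have hB := B.map_smul c ⟨x.1.1, x.2.1⟩
        exact Prod.ext hA ((congrArg Neg.neg hB).trans (smul_neg _ _).symm) }

/-- The linearized Gross-Pitaevskii operator `ℒ_GP = (0, 𝔏₁; -𝔏₂, 0)` in `L² × L²`. -/
def linearizedGP (ρ : ℝ → ℝ) : (L2 × L2) →ₗ.[ℂ] (L2 × L2) := offDiagonal (frakL₁ ρ) (frakL₂ ρ)

/-- `μ` is an eigenvalue of the (unbounded) operator `T`. -/
def HasEigenvalue {E : Type*} [AddCommGroup E] [Module ℂ E] (T : E →ₗ.[ℂ] E) (μ : ℂ) : Prop :=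
  ∃ x : T.domain, (x : E) ≠ 0 ∧ T x = μ • (x : E)

end GrossPitaevskii

end

/-! Multiplying `ψ` by `-i` times the sign of `λ` and taking real and imaginary parts reduces the
eigenvalue equation to the real system `y'' = 2(V₁ y + l φ)`, `φ'' = 2(V₂ φ + l y)` with `l = |λ|`.
The positive coupling `l` makes the system cooperative, and a Sturm argument run from infinity down
to the origin excludes nonzero `L²` solutions.

At infinity `V₁ → 1/8` and `V₂ → 17/8` exponentially fast, so the limiting matrix has eigenvalues
`2(9/8 ± S)`, `S = √(1 + l²)`. The smaller one is nonpositive exactly when `l ≥ √17/8`. Then only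
one mode can decay, and its direction `(l, 1 + S)` has positive entries. Hence far out a nonzero
`L²` solution has, up to a global sign, `y, φ > 0` with `y' ≤ -y` and `φ' ≤ -φ`
(`exists_dominated_point`, `eq_zero_or_exists_signs`).

Now compare with `f = √(sinh r) ρ > 0`, which satisfies `𝔏₁ f = 0`. At such a point the Wronskians
`y' f - y f'` and `φ' f - φ f'` are negative. While `y, φ ≥ 0` they are nondecreasing in `r`, so to
the left they stay negative and `y/f`, `φ/f` keep growing; thus positivity persists down to `0`
(`pos_left`).

Near `0` one has `f ~ r^(3/2)`, and `(y/f)' ≤ -c/f²` forces `y ≥ const · r^(-1/2)`, which is not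
square integrable (`not_sq_integrable_of_wronskian`). -/

namespace GrossPitaevskii

/-! ### Maximum principle and uniqueness for the Cauchy problem. -/

/-- Maximum principle: a function that is strictly convex at its positive critical points, and is
not maximal towards either end of the interval `s`, is nonpositive. -/
theorem nonpos_of_convex_at_critical {u u₁ u₂ : ℝ → ℝ} {s : Set ℝ} (hs : s.OrdConnected)
    (hu : ∀ r ∈ s, HasDerivAt u (u₁ r) r) (hu₁ : ∀ r ∈ s, HasDerivAt u₁ (u₂ r) r)
    (hl : ∀ r ∈ s, 0 < u r → ∃ a ∈ s, a < r ∧ u a < u r)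
    (hr : ∀ r ∈ s, 0 < u r → ∃ b ∈ s, r < b ∧ u b < u r)
    (hpos : ∀ r ∈ s, 0 < u r → u₁ r = 0 → 0 < u₂ r) : ∀ r ∈ s, u r ≤ 0 := by
  intro x hx
  by_contra! hux
  obtain ⟨a, ha, hax, hua⟩ := hl x hx hux
  obtain ⟨b, hb, hxb, hub⟩ := hr x hx hux
  have hsub : Icc a b ⊆ s := hs.out ha hb
  obtain ⟨c, hc, hmax⟩ := isCompact_Icc.exists_isMaxOn ⟨x, hax.le, hxb.le⟩
    (fun r hr => (hu r (hsub hr)).continuousAt.continuousWithinAt : ContinuousOn u (Icc a b))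
  have hxc : u x ≤ u c := hmax ⟨hax.le, hxb.le⟩
  have hca : a < c := lt_of_le_of_ne hc.1 (by rintro rfl; linarith)
  have hcb : c < b := lt_of_le_of_ne hc.2 (by rintro rfl; linarith)
  have hlm : IsLocalMax u c := hmax.isLocalMax (Icc_mem_nhds hca hcb)
  have h1 : u₁ c = 0 := hlm.hasDerivAt_eq_zero (hu c (hsub hc))
  have h2 := hpos c (hsub hc) (hux.trans_le hxc) h1
  have hev : deriv u =ᶠ[𝓝 c] u₁ := by
    filter_upwards [Icc_mem_nhds hca hcb] with r hr using (hu r (hsub hr)).deriv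
  have hd2 : deriv (deriv u) c = u₂ c := by rw [hev.deriv_eq, (hu₁ c (hsub hc)).deriv]
  -- A positive second derivative makes the maximum a local minimum too; then `u` is locally
  -- constant and its second derivative vanishes.
  have hmin : IsLocalMin u c := isLocalMin_of_deriv_deriv_pos (by rw [hd2]; exact h2)
    (by rw [hev.eq_of_nhds, h1]) (hu c (hsub hc)).continuousAt
  have hconst : u =ᶠ[𝓝 c] fun _ => u c := by
    filter_upwards [hlm, hmin] with r hr1 hr2 using le_antisymm hr1 hr2
  have : deriv (deriv u) c = 0 := by
    rw [hconst.deriv.deriv_eq]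
    simp
  linarith

/-- Gronwall uniqueness on `(0, ∞)`. -/
theorem eq_zero_of_abs_deriv_le {N N' K : ℝ → ℝ} (hN : ∀ r, 0 < r → HasDerivAt N (N' r) r)
    (hK : ContinuousOn K (Ioi 0)) (hb : ∀ r, 0 < r → |N' r| ≤ K r * N r)
    (h0 : ∀ r, 0 < r → 0 ≤ N r) {r₀ : ℝ} (hr₀ : 0 < r₀) (hz : N r₀ = 0) :
    ∀ r, 0 < r → N r = 0 := by
  intro r hr
  have hexp : ∀ c t : ℝ, 0 < t → HasDerivAt (fun t => N t * Real.exp (c * t))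
      ((N' t + c * N t) * Real.exp (c * t)) t := by
    intro c t ht
    have h1 : HasDerivAt (fun t => Real.exp (c * t)) (Real.exp (c * t) * (c * 1)) t :=
      ((hasDerivAt_id t).const_mul c).exp
    exact ((hN t ht).mul h1).congr_deriv (by ring)
  have hbd : ∀ a b : ℝ, 0 < a → ∃ C, ∀ t ∈ Icc a b, |N' t| ≤ C * N t := by
    intro a b ha
    have hsub : Icc a b ⊆ Ioi 0 := fun t ht => ha.trans_le ht.1
    obtain ⟨C, hC⟩ := isCompact_Icc.bddAbove_image (hK.mono hsub)
    exact ⟨C, fun t ht => (hb t (hsub ht)).trans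
      (mul_le_mul_of_nonneg_right (hC (mem_image_of_mem K ht)) (h0 t (hsub ht)))⟩
  rcases le_total r₀ r with h | h
  · obtain ⟨C, hC⟩ := hbd r₀ r hr₀
    have hanti : AntitoneOn (fun t => N t * Real.exp (-C * t)) (Icc r₀ r) := by
      refine antitoneOn_of_hasDerivWithinAt_nonpos (convex_Icc _ _)
        (fun t ht => (hexp (-C) t (hr₀.trans_le ht.1)).continuousAt.continuousWithinAt)
        (fun t ht => (hexp (-C) t (hr₀.trans_le (interior_subset ht).1)).hasDerivWithinAt) ?_
      intro t ht
      have := (abs_le.1 (hC t (interior_subset ht))).2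
      exact mul_nonpos_of_nonpos_of_nonneg (by linarith) (Real.exp_pos _).le
    have := hanti (left_mem_Icc.2 h) (right_mem_Icc.2 h) h
    simp only [hz, zero_mul] at this
    exact le_antisymm (nonpos_of_mul_nonpos_left this (Real.exp_pos _)) (h0 r hr)
  · obtain ⟨C, hC⟩ := hbd r r₀ hr
    have hmono : MonotoneOn (fun t => N t * Real.exp (C * t)) (Icc r r₀) := by
      refine monotoneOn_of_hasDerivWithinAt_nonneg (convex_Icc _ _)
        (fun t ht => (hexp C t (hr.trans_le ht.1)).continuousAt.continuousWithinAt)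
        (fun t ht => (hexp C t (hr.trans_le (interior_subset ht).1)).hasDerivWithinAt) ?_
      intro t ht
      have := (abs_le.1 (hC t (interior_subset ht))).1
      exact mul_nonneg (by linarith) (Real.exp_pos _).le
    have := hmono (left_mem_Icc.2 h) (right_mem_Icc.2 h) h
    simp only [hz, zero_mul] at this
    exact le_antisymm (nonpos_of_mul_nonpos_left this (Real.exp_pos _)) (h0 r hr)

/-! ### Decaying solutions of asymptotically constant systems. -/

/-- `F - A e^(-κ r)` is nondecreasing with limit `L`, hence stays below `L`. -/
theorem le_add_exp_of_tendsto {F F' : ℝ → ℝ} {A κ L R : ℝ} (hκ : 0 < κ)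
    (hF : ∀ r, R ≤ r → HasDerivAt F (F' r) r)
    (hb : ∀ r, R ≤ r → -(A * κ * Real.exp (-κ * r)) ≤ F' r) (hL : Tendsto F atTop (𝓝 L)) :
    ∀ r, R ≤ r → F r ≤ L + A * Real.exp (-κ * r) := by
  intro r hr
  have hd : ∀ t, R ≤ t → HasDerivAt (fun t => F t - A * Real.exp (-κ * t))
      (F' t + A * κ * Real.exp (-κ * t)) t := by
    intro t ht
    have h1 : HasDerivAt (fun t => Real.exp (-κ * t)) (Real.exp (-κ * t) * (-κ * 1)) t :=
      ((hasDerivAt_id t).const_mul (-κ)).exp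
    exact ((hF t ht).sub (h1.const_mul A)).congr_deriv (by ring)
  have hmono : MonotoneOn (fun t => F t - A * Real.exp (-κ * t)) (Ici R) := by
    refine monotoneOn_of_hasDerivWithinAt_nonneg (convex_Ici _)
      (fun t ht => (hd t ht).continuousAt.continuousWithinAt)
      (fun t ht => (hd t (interior_subset ht)).hasDerivWithinAt) ?_
    intro t ht
    have := hb t (interior_subset ht)
    linarith
  have hexp : Tendsto (fun t => Real.exp (-κ * t)) atTop (𝓝 0) :=
    Real.tendsto_exp_atBot.comp (tendsto_id.const_mul_atTop_of_neg (neg_neg_of_pos hκ))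
  have hlim : Tendsto (fun t => F t - A * Real.exp (-κ * t)) atTop (𝓝 L) := by
    simpa using hL.sub (hexp.const_mul A)
  have := ge_of_tendsto hlim (eventually_atTop.2 ⟨r, fun t ht => hmono hr (hr.trans ht) ht⟩)
  linarith

theorem abs_le_exp_of_tendsto_zero {F F' : ℝ → ℝ} {A κ R : ℝ} (hκ : 0 < κ)
    (hF : ∀ r, R ≤ r → HasDerivAt F (F' r) r)
    (hb : ∀ r, R ≤ r → |F' r| ≤ A * κ * Real.exp (-κ * r)) (hL : Tendsto F atTop (𝓝 0)) :
    ∀ r, R ≤ r → |F r| ≤ A * Real.exp (-κ * r) := by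
  intro r hr
  have h1 := le_add_exp_of_tendsto hκ hF (fun t ht => (abs_le.1 (hb t ht)).1) hL r hr
  have h2 := le_add_exp_of_tendsto (F := fun t => -F t) (A := A) hκ (fun t ht => (hF t ht).neg)
    (fun t ht => neg_le_neg (abs_le.1 (hb t ht)).2) (L := 0) (by simpa using hL.neg) r hr
  rw [abs_le]
  constructor <;> linarith

/-- A decaying solution of `p'' = -ω² p + h` with exponentially decaying `h`. -/
theorem oscillating_mode_bound {p p₁ h : ℝ → ℝ} {w A R : ℝ} (hw : 0 ≤ w)
    (hp : ∀ r, R ≤ r → HasDerivAt p (p₁ r) r)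
    (hp₁ : ∀ r, R ≤ r → HasDerivAt p₁ (-w * p r + h r) r)
    (hh : ∀ r, R ≤ r → |h r| ≤ A * Real.exp (-r))
    (h0 : Tendsto p atTop (𝓝 0)) (h1 : Tendsto p₁ atTop (𝓝 0)) :
    ∀ r, R ≤ r → |p r| ≤ A * Real.exp (-r) ∧ |p₁ r| ≤ A * Real.exp (-r) := by
  have key : ∀ r, R ≤ r → |p₁ r| ≤ A * Real.exp (-r) := by
    intro r hr
    refine le_of_forall_pos_le_add fun ε hε => ?_
    -- Energy of the free oscillator: only the forcing changes it, so `|(√E)'| ≤ |h|`. The `ε ^ 2`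
    -- keeps the root differentiable. For `w = 0` the energy still controls `p₁`, and `p` follows by
    -- integration.
    set E : ℝ → ℝ := fun t => p₁ t ^ 2 + w * p t ^ 2 + ε ^ 2 with hE
    have hEpos : ∀ t, 0 < E t := fun t => by positivity
    have hd : ∀ t, R ≤ t → HasDerivAt (fun t => √(E t)) (p₁ t * h t / √(E t)) t := by
      intro t ht
      have h2 : HasDerivAt E (2 * p₁ t * h t) t := by
        refine (((hp₁ t ht).pow 2).add (((hp t ht).pow 2).const_mul w)).add_const (ε ^ 2)
          |>.congr_deriv ?_
        push_cast
        ring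
      refine (h2.sqrt (hEpos t).ne').congr_deriv ?_
      field_simp
    have hle : ∀ t, |p₁ t| ≤ √(E t) := fun t => by
      refine Real.abs_le_sqrt ?_
      have : 0 ≤ w * p t ^ 2 := by positivity
      simp only [hE]
      nlinarith
    have hlim : Tendsto (fun t => √(E t)) atTop (𝓝 ε) := by
      have : Tendsto E atTop (𝓝 (0 ^ 2 + w * 0 ^ 2 + ε ^ 2)) :=
        ((h1.pow 2).add ((h0.pow 2).const_mul w)).add_const _
      have h3 := this.sqrt
      simpa [Real.sqrt_sq hε.le] using h3
    have := le_add_exp_of_tendsto (A := A) (κ := 1) one_pos hd (fun t ht => ?_) hlim r hr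
    · have h4 := hle r
      simp only [neg_one_mul] at this
      linarith
    · have hs : 0 < √(E t) := Real.sqrt_pos.2 (hEpos t)
      have h5 : |p₁ t * h t / √(E t)| ≤ A * Real.exp (-t) := by
        rw [abs_div, abs_mul, abs_of_pos hs, div_le_iff₀ hs]
        have h6 := hh t ht
        calc |p₁ t| * |h t| ≤ √(E t) * (A * Real.exp (-t)) :=
              mul_le_mul (hle t) h6 (abs_nonneg _) hs.le
          _ = _ := by ring
      have h7 := (abs_le.1 h5).1
      simpa using h7
  intro r hr
  refine ⟨?_, key r hr⟩
  have := abs_le_exp_of_tendsto_zero (A := A) (κ := 1) one_pos hp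
    (fun t ht => by simpa using key t ht) h0 r hr
  simpa using this

/-- A decaying solution of `q'' = k² q + h` with exponentially decaying `h`. -/
theorem decaying_mode_bound {q q₁ h : ℝ → ℝ} {k A R : ℝ} (hk : 0 < k)
    (hq : ∀ r, R ≤ r → HasDerivAt q (q₁ r) r)
    (hq₁ : ∀ r, R ≤ r → HasDerivAt q₁ (k ^ 2 * q r + h r) r)
    (hh : ∀ r, R ≤ r → |h r| ≤ A * Real.exp (-r))
    (h0 : Tendsto q atTop (𝓝 0)) (h1 : Tendsto q₁ atTop (𝓝 0)) :
    ∀ r, R ≤ r → |q₁ r + k * q r| ≤ A * Real.exp (-r) := by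
  intro r hr
  -- `q' + k q` is the component along the growing mode; the factor `e^(-k t)` removes its
  -- homogeneous growth and leaves only the forcing.
  have hd : ∀ t, R ≤ t → HasDerivAt (fun t => Real.exp (-k * t) * (q₁ t + k * q t))
      (Real.exp (-k * t) * h t) t := by
    intro t ht
    have h1 : HasDerivAt (fun t => Real.exp (-k * t)) (Real.exp (-k * t) * (-k * 1)) t :=
      ((hasDerivAt_id t).const_mul (-k)).exp
    exact (h1.mul ((hq₁ t ht).add ((hq t ht).const_mul k))).congr_deriv (by simp only [Pi.add_apply]; ring)
  have hA : 0 ≤ A := by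
    have := (abs_nonneg _).trans (hh r hr)
    exact nonneg_of_mul_nonneg_left this (Real.exp_pos _)
  have hexp : Tendsto (fun t => Real.exp (-k * t)) atTop (𝓝 0) :=
    Real.tendsto_exp_atBot.comp (tendsto_id.const_mul_atTop_of_neg (neg_neg_of_pos hk))
  have := abs_le_exp_of_tendsto_zero (A := A) (κ := k + 1) (by linarith) hd (fun t ht => ?_)
    (by simpa using hexp.mul (h1.add (h0.const_mul k))) r hr
  · rw [abs_mul, abs_of_pos (Real.exp_pos _)] at this
    have h2 : Real.exp (-(k + 1) * r) = Real.exp (-k * r) * Real.exp (-r) := by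
      rw [← Real.exp_add]; ring_nf
    rw [h2] at this
    refine le_of_mul_le_mul_left (this.trans_eq ?_) (Real.exp_pos (-k * r))
    ring
  · have h2 : Real.exp (-(k + 1) * t) = Real.exp (-k * t) * Real.exp (-t) := by
      rw [← Real.exp_add]; ring_nf
    rw [abs_mul, abs_of_pos (Real.exp_pos _), h2]
    have h3 := hh t ht
    have h4 : 0 ≤ A * Real.exp (-t) := by positivity
    calc Real.exp (-k * t) * |h t| ≤ Real.exp (-k * t) * ((k + 1) * (A * Real.exp (-t))) := by
          gcongr; nlinarith
      _ = _ := by ring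

theorem exists_isMax_abs_Ici {f : ℝ → ℝ} {R : ℝ} (hf : ContinuousOn f (Ici R))
    (h0 : Tendsto f atTop (𝓝 0)) : ∃ r, R ≤ r ∧ ∀ t, R ≤ t → |f t| ≤ |f r| := by
  by_cases hz : ∀ t, R ≤ t → f t = 0
  · exact ⟨R, le_rfl, fun t ht => by simp [hz t ht, hz R le_rfl]⟩
  push Not at hz
  obtain ⟨t₀, ht₀, hne⟩ := hz
  have hev : ∀ᶠ t in atTop, |f t| < |f t₀| := by
    have : Tendsto (fun t => |f t|) atTop (𝓝 0) := by simpa using h0.abs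
    exact this.eventually (gt_mem_nhds (abs_pos.2 hne))
  obtain ⟨b, hb⟩ := eventually_atTop.1 hev
  obtain ⟨c, hc, hmax⟩ := (isCompact_Icc (a := R) (b := max b t₀)).exists_isMaxOn
    ⟨t₀, ht₀, le_max_right _ _⟩ ((hf.mono Icc_subset_Ici_self).abs)
  refine ⟨c, hc.1, fun t ht => ?_⟩
  rcases le_total t (max b t₀) with h | h
  · exact hmax ⟨ht, h⟩
  · exact (hb t ((le_max_left _ _).trans h)).le.trans (hmax ⟨ht₀, le_max_right _ _⟩)

/-- Solutions decaying at infinity are dominated by the exponentially decaying mode. -/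
theorem exists_dominated_point {p p₁ hp q q₁ hq : ℝ → ℝ} {w k C R θ : ℝ} (hw : 0 ≤ w) (hk : 0 < k)
    (hC : 0 ≤ C) (hθ : 0 < θ)
    (dp : ∀ r, R ≤ r → HasDerivAt p (p₁ r) r)
    (dp₁ : ∀ r, R ≤ r → HasDerivAt p₁ (-w * p r + hp r) r)
    (dq : ∀ r, R ≤ r → HasDerivAt q (q₁ r) r)
    (dq₁ : ∀ r, R ≤ r → HasDerivAt q₁ (k ^ 2 * q r + hq r) r)
    (bp : ∀ r, R ≤ r → |hp r| ≤ C * Real.exp (-r) * (|p r| + |q r|))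
    (bq : ∀ r, R ≤ r → |hq r| ≤ C * Real.exp (-r) * (|p r| + |q r|))
    (p0 : Tendsto p atTop (𝓝 0)) (p0' : Tendsto p₁ atTop (𝓝 0))
    (q0 : Tendsto q atTop (𝓝 0)) (q0' : Tendsto q₁ atTop (𝓝 0)) :
    ∃ r, R ≤ r ∧ |p r| ≤ θ * |q r| ∧ |p₁ r| ≤ θ * |q r| ∧ |q₁ r + k * q r| ≤ θ * |q r| := by
  have hexp : Tendsto (fun t => C * Real.exp (-t)) atTop (𝓝 0) := by
    simpa using (Real.tendsto_exp_neg_atTop_nhds_zero).const_mul C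
  obtain ⟨R₁, hR₁⟩ := eventually_atTop.1
    ((hexp.eventually (gt_mem_nhds (show (0 : ℝ) < min (1 / 2) (θ / 2) by positivity))).and
      (eventually_ge_atTop R))
  have hRR : R ≤ R₁ := (hR₁ R₁ le_rfl).2
  -- The point is where `|q|` is maximal on `[R₁, ∞)`: from there on the forcing is bounded by `C M
  -- e^(-t)`, with `M` built from `|q r₀|` and the later maximum of `|p|`.
  obtain ⟨r₀, hr₀, hmax⟩ := exists_isMax_abs_Ici (f := q) (R := R₁)
    (fun t ht => (dq t (hRR.trans ht)).continuousAt.continuousWithinAt) q0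
  have hRr : R ≤ r₀ := hRR.trans hr₀
  obtain ⟨t₁, ht₁, hmaxp⟩ := exists_isMax_abs_Ici (f := p) (R := r₀)
    (fun t ht => (dp t (hRr.trans ht)).continuousAt.continuousWithinAt) p0
  set M := |p t₁| + |q r₀| with hM
  have hMn : 0 ≤ M := by positivity
  have hsmall : ∀ t, r₀ ≤ t → C * Real.exp (-t) < 1 / 2 ∧ C * Real.exp (-t) < θ / 2 :=
    fun t ht => lt_min_iff.1 (hR₁ t (hr₀.trans ht)).1
  have hsum : ∀ t, r₀ ≤ t → |p t| + |q t| ≤ M := fun t ht =>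
    add_le_add (hmaxp t ht) (hmax t (hr₀.trans ht))
  have hb : ∀ g : ℝ → ℝ, (∀ r, R ≤ r → |g r| ≤ C * Real.exp (-r) * (|p r| + |q r|)) →
      ∀ t, r₀ ≤ t → |g t| ≤ C * M * Real.exp (-t) := by
    intro g hg t ht
    calc |g t| ≤ C * Real.exp (-t) * (|p t| + |q t|) := hg t (hRr.trans ht)
      _ ≤ C * Real.exp (-t) * M := by
        have := hsum t ht
        have := Real.exp_pos (-t)
        gcongr
      _ = _ := by ring
  have hP := oscillating_mode_bound hw (fun r hr => dp r (hRr.trans hr))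
    (fun r hr => dp₁ r (hRr.trans hr)) (hb hp bp) p0 p0'
  have hQ := decaying_mode_bound hk (fun r hr => dq r (hRr.trans hr))
    (fun r hr => dq₁ r (hRr.trans hr)) (hb hq bq) q0 q0'
  -- At its maximum, `|p| ≤ C M e^(-t₁) ≤ M / 2`, so the contribution of `p` to `M` is absorbed.
  have hM2 : M ≤ 2 * |q r₀| := by
    have h1 := (hP t₁ ht₁).1
    have h2 := (hsmall t₁ ht₁).1
    nlinarith
  have hfin : C * M * Real.exp (-r₀) ≤ θ * |q r₀| := by
    have h2 := (hsmall r₀ le_rfl).2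
    have := abs_nonneg (q r₀)
    nlinarith
  exact ⟨r₀, hRr, (hP r₀ le_rfl).1.trans hfin, (hP r₀ le_rfl).2.trans hfin,
    (hQ r₀ le_rfl).trans hfin⟩

/-! ### The vortex profile: positivity and behaviour at both ends. -/

theorem continuousOn_inv_sinh_sq : ContinuousOn (fun r : ℝ => 1 / Real.sinh r ^ 2) (Ioi 0) :=
  continuousOn_const.div (Real.continuous_sinh.pow 2).continuousOn
    fun _ hr => (pow_pos (Real.sinh_pos_iff.2 hr) 2).ne'

theorem exp_le_four_mul_sinh {r : ℝ} (hr : 1 ≤ r) : Real.exp r ≤ 4 * Real.sinh r := by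
  have h1 : Real.exp (-r) ≤ 1 := Real.exp_le_one_iff.2 (by linarith)
  have h2 : 2 ≤ Real.exp r := by linarith [Real.add_one_le_exp r]
  rw [Real.sinh_eq]
  linarith

theorem inv_sinh_sq_le {r : ℝ} (hr : 1 ≤ r) : 1 / Real.sinh r ^ 2 ≤ 16 * Real.exp (-r) := by
  have h1 := exp_le_four_mul_sinh hr
  have h2 : 1 ≤ Real.exp r := Real.one_le_exp (by linarith)
  have hs : 0 < Real.sinh r := Real.sinh_pos_iff.2 (by linarith)
  rw [Real.exp_neg, div_le_iff₀ (by positivity)]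
  have : (1 : ℝ) = 16 * (Real.exp r)⁻¹ * (Real.exp r / 16) := by field_simp
  rw [this]
  gcongr
  nlinarith

namespace IsVortexProfile

variable {ρ : ℝ → ℝ}

theorem hasDerivAt (hρ : IsVortexProfile ρ) {r : ℝ} (hr : 0 < r) : HasDerivAt ρ (deriv ρ r) r :=
  ((hρ.smooth.contDiffAt (Ioi_mem_nhds hr)).differentiableAt (by simp)).hasDerivAt

theorem hasDerivAt_deriv (hρ : IsVortexProfile ρ) {r : ℝ} (hr : 0 < r) :
    HasDerivAt (deriv ρ) (deriv (deriv ρ) r) r := by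
  have h : ContDiffOn ℝ 1 (deriv ρ) (Ioi 0) :=
    hρ.smooth.deriv_of_isOpen isOpen_Ioi
      (WithTop.coe_le_coe.2 (le_top : (1 + 1 : ℕ∞) ≤ ⊤))
  exact ((h.contDiffAt (Ioi_mem_nhds hr)).differentiableAt (by simp)).hasDerivAt

theorem continuousOn (hρ : IsVortexProfile ρ) : ContinuousOn ρ (Ioi 0) := hρ.smooth.continuousOn

theorem deriv_deriv_eq (hρ : IsVortexProfile ρ) {r : ℝ} (hr : 0 < r) :
    deriv (deriv ρ) r = (1 / Real.sinh r ^ 2 - 2 * (1 - ρ r ^ 2)) * ρ r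
      - Real.cosh r / Real.sinh r * deriv ρ r := by
  have h := hρ.ode r hr
  have hs : 0 < Real.sinh r := Real.sinh_pos_iff.2 hr
  have : 1 / (2 * Real.sinh r ^ 2) = 1 / 2 * (1 / Real.sinh r ^ 2) := by field_simp
  rw [this] at h
  linear_combination 2 * h

theorem sinh_sq_mul_deriv_deriv (hρ : IsVortexProfile ρ) {r : ℝ} (hr : 0 < r) :
    Real.sinh r ^ 2 * deriv (deriv ρ) r = (1 - 2 * Real.sinh r ^ 2 * (1 - ρ r ^ 2)) * ρ r
      - Real.cosh r * Real.sinh r * deriv ρ r := by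
  have hs : 0 < Real.sinh r := Real.sinh_pos_iff.2 hr
  rw [hρ.deriv_deriv_eq hr]
  field_simp

/-- A zero would be an interior minimum, hence a zero of the Cauchy data; uniqueness would give `ρ =
0`, against the limit `1`. -/
theorem pos (hρ : IsVortexProfile ρ) {r : ℝ} (hr : 0 < r) : 0 < ρ r := by
  refine (hρ.nonneg r hr).lt_of_ne' fun hz => ?_
  have hmin : IsLocalMin ρ r := by
    filter_upwards [Ioi_mem_nhds hr] with t ht
    rw [hz]
    exact hρ.nonneg t ht
  have hd : deriv ρ r = 0 := hmin.deriv_eq_zero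
  have hall := eq_zero_of_abs_deriv_le (N := fun t => ρ t ^ 2 + deriv ρ t ^ 2)
    (N' := fun t => 2 * ρ t * deriv ρ t + 2 * deriv ρ t * deriv (deriv ρ) t)
    (K := fun t => 1 + |1 / Real.sinh t ^ 2 - 2 * (1 - ρ t ^ 2)|
      + 2 * |Real.cosh t / Real.sinh t|) (r₀ := r)
    (fun t ht => (((hρ.hasDerivAt ht).pow 2).add ((hρ.hasDerivAt_deriv ht).pow 2)).congr_deriv
      (by push_cast; ring)) ?_ ?_ (fun t _ => by positivity) hr (by simp [hz, hd])
  · obtain ⟨t, ht, ht0⟩ := ((hρ.tendsto_one.eventually (lt_mem_nhds one_half_lt_one)).and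
      (eventually_gt_atTop 0)).exists
    have := hall t ht0
    have : ρ t ^ 2 = 0 := by nlinarith [sq_nonneg (deriv ρ t), sq_nonneg (ρ t)]
    have : ρ t = 0 := by simpa using this
    linarith
  · have h1 : ContinuousOn (fun t : ℝ => Real.cosh t / Real.sinh t) (Ioi 0) :=
      Real.continuous_cosh.continuousOn.div Real.continuous_sinh.continuousOn
        fun _ ht => (Real.sinh_pos_iff.2 ht).ne'
    have h2 := (continuousOn_inv_sinh_sq.sub
      (continuousOn_const.mul (continuousOn_const.sub (hρ.continuousOn.pow 2)) :
        ContinuousOn (fun t => (2 : ℝ) * (1 - ρ t ^ 2)) (Ioi 0))).abs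
    exact (continuousOn_const.add h2).add (continuousOn_const.mul h1.abs)
  · intro t ht
    rw [hρ.deriv_deriv_eq ht]
    generalize 1 / Real.sinh t ^ 2 - 2 * (1 - ρ t ^ 2) = a
    generalize Real.cosh t / Real.sinh t = b
    generalize ρ t = x
    generalize deriv ρ t = z
    have hxz : 2 * |x * z| ≤ x ^ 2 + z ^ 2 := by
      rw [abs_mul]
      nlinarith [sq_nonneg (|x| - |z|), sq_abs x, sq_abs z]
    calc |2 * x * z + 2 * z * (a * x - b * z)|
        = |2 * (x * z) + a * (2 * (x * z)) + -(b * (2 * z ^ 2))| := by congr 1; ring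
      _ ≤ |2 * (x * z)| + |a * (2 * (x * z))| + |-(b * (2 * z ^ 2))| := abs_add_three _ _ _
      _ = 2 * |x * z| + |a| * (2 * |x * z|) + |b| * (2 * z ^ 2) := by
        simp [abs_mul, abs_neg]
      _ ≤ (x ^ 2 + z ^ 2) + |a| * (x ^ 2 + z ^ 2) + |b| * (2 * (x ^ 2 + z ^ 2)) := by
        gcongr
        nlinarith [sq_nonneg x]
      _ = _ := by ring

/-- The profile approaches `1` exponentially fast. -/
theorem exists_abs_one_sub_le (hρ : IsVortexProfile ρ) :
    ∃ R K : ℝ, 1 ≤ R ∧ 0 ≤ K ∧ ∀ r, R ≤ r → ρ r ≤ 2 ∧ |1 - ρ r| ≤ K * Real.exp (-r) := by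
  obtain ⟨R, hR⟩ := eventually_atTop.1 ((hρ.tendsto_one.eventually
    (Icc_mem_nhds (a := 9 / 10) (b := 11 / 10) (by norm_num) (by norm_num))).and
    (eventually_ge_atTop 1))
  have hR1 : 1 ≤ R := (hR R le_rfl).2
  -- The term `e^R` puts the barrier `K e^(-r)` above `1` at `r = R`; the `6` makes `3 K e^(-r)`
  -- exceed the bound `18 e^(-r)` for `ρ / sinh²`.
  set K := 6 + Real.exp R with hK
  have hKpos : 0 < K := by positivity
  have main : ∀ σ : ℝ, σ = 1 ∨ σ = -1 → ∀ r ∈ Ici R,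
      σ * (1 - ρ r) - K * Real.exp (-r) ≤ 0 := by
    intro σ hσ
    have hσ1 : σ ^ 2 = 1 := by rcases hσ with rfl | rfl <;> norm_num
    have hdexp : ∀ r : ℝ, HasDerivAt (fun t => Real.exp (-t)) (-Real.exp (-r)) r := fun r => by
      simpa using (hasDerivAt_neg r).exp
    have hlim : Tendsto (fun r => σ * (1 - ρ r) - K * Real.exp (-r)) atTop (𝓝 0) := by
      have := ((hρ.tendsto_one.const_sub 1).const_mul σ).sub
        (Real.tendsto_exp_neg_atTop_nhds_zero.const_mul K)
      simpa using this
    have hRle : σ * (1 - ρ R) - K * Real.exp (-R) ≤ 0 := by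
      obtain ⟨h1, h2⟩ := (hR R le_rfl).1
      have h3 : 1 ≤ K * Real.exp (-R) := by
        have : Real.exp R * Real.exp (-R) = 1 := by rw [← Real.exp_add]; simp
        nlinarith [Real.exp_pos (-R)]
      rcases hσ with rfl | rfl <;> linarith
    refine nonpos_of_convex_at_critical (u₁ := fun r => -(σ * deriv ρ r) + K * Real.exp (-r))
      (u₂ := fun r => -(σ * deriv (deriv ρ) r) - K * Real.exp (-r)) ordConnected_Ici ?_ ?_ ?_ ?_ ?_
    · intro r hr
      have hr0 : 0 < r := by linarith [mem_Ici.1 hr]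
      exact ((((hρ.hasDerivAt hr0).const_sub 1).const_mul σ).sub
        ((hdexp r).const_mul K)).congr_deriv (by ring)
    · intro r hr
      have hr0 : 0 < r := by linarith [mem_Ici.1 hr]
      exact ((((hρ.hasDerivAt_deriv hr0).const_mul σ).neg).add
        ((hdexp r).const_mul K)).congr_deriv (by ring)
    · intro r hr hpos
      refine ⟨R, self_mem_Ici, lt_of_le_of_ne hr ?_, by linarith⟩
      rintro rfl
      linarith
    · intro r hr hpos
      obtain ⟨b, hb1, hb2⟩ := ((hlim.eventually (gt_mem_nhds hpos)).and
        (eventually_gt_atTop r)).exists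
      exact ⟨b, (mem_Ici.1 hr).trans hb2.le, hb2, hb1⟩
    · intro r hr hpos hcrit
      have hrR := mem_Ici.1 hr
      have hr0 : 0 < r := by linarith
      obtain ⟨⟨h1, h2⟩, h3⟩ := hR r hrR
      have hs : 0 < Real.sinh r := Real.sinh_pos_iff.2 hr0
      have hcoth : 1 ≤ Real.cosh r / Real.sinh r := by
        rw [one_le_div hs]
        exact (Real.sinh_lt_cosh r).le
      have hinv := inv_sinh_sq_le h3
      have he := Real.exp_pos (-r)
      have hinv0 : 0 < 1 / Real.sinh r ^ 2 := by positivity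
      rw [hρ.deriv_deriv_eq hr0]
      -- At a critical point `σ ρ' = K e^(-r)`, which eliminates `ρ'` and leaves the nonnegative
      -- term with `coth r - 1`.
      have hid : -(σ * ((1 / Real.sinh r ^ 2 - 2 * (1 - ρ r ^ 2)) * ρ r
          - Real.cosh r / Real.sinh r * deriv ρ r)) - K * Real.exp (-r)
          = -(σ * (1 / Real.sinh r ^ 2) * ρ r) + 2 * ρ r * (1 + ρ r) * (σ * (1 - ρ r))
            + (Real.cosh r / Real.sinh r - 1) * (K * Real.exp (-r)) := by
        linear_combination -(Real.cosh r / Real.sinh r) * hcrit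
      rw [hid]
      have hKe : 6 * Real.exp (-r) < K * Real.exp (-r) := by
        have := Real.exp_pos R
        gcongr
        linarith
      have t1 : σ * (1 / Real.sinh r ^ 2) * ρ r ≤ 18 * Real.exp (-r) := by
        have : (1 / Real.sinh r ^ 2) * ρ r ≤ 16 * Real.exp (-r) * (11 / 10) := by gcongr
        have h0 : 0 ≤ (1 / Real.sinh r ^ 2) * ρ r := by positivity
        rcases hσ with rfl | rfl <;> nlinarith
      have t2 : 3 * (K * Real.exp (-r)) ≤ 2 * ρ r * (1 + ρ r) * (σ * (1 - ρ r)) := by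
        have : (3 : ℝ) ≤ 2 * ρ r * (1 + ρ r) := by nlinarith
        have hKe0 : 0 < K * Real.exp (-r) := by positivity
        nlinarith
      have t3 : 0 ≤ (Real.cosh r / Real.sinh r - 1) * (K * Real.exp (-r)) :=
        mul_nonneg (by linarith) (by positivity)
      linarith
  refine ⟨R, K, hR1, hKpos.le, fun r hr => ⟨by linarith [(hR r hr).1.2], ?_⟩⟩
  have h1 := main 1 (Or.inl rfl) r hr
  have h2 := main (-1) (Or.inr rfl) r hr
  rw [abs_le]
  constructor <;> linarith

/-- The profile is comparable to `sinh r` near the origin. -/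
theorem exists_sinh_bounds (hρ : IsVortexProfile ρ) :
    ∃ r₁ κ K : ℝ, 0 < r₁ ∧ 0 < κ ∧ 0 < K ∧
      ∀ r ∈ Ioc 0 r₁, κ * Real.sinh r ≤ ρ r ∧ ρ r ≤ K * Real.sinh r := by
  have hsinh0 : Tendsto Real.sinh (𝓝[>] 0) (𝓝 0) := by
    have := (Real.continuous_sinh.tendsto 0).mono_left (nhdsWithin_le_nhds (s := Ioi (0 : ℝ)))
    simpa using this
  obtain ⟨r₁, hr₁, hlt⟩ := mem_nhdsGT_iff_exists_Ioc_subset.1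
    ((hρ.tendsto_zero.eventually (gt_mem_nhds one_pos)).and
      (hsinh0.eventually (gt_mem_nhds one_half_pos)))
  have hr₁' : 0 < r₁ := hr₁
  have hbd : ∀ r ∈ Ioc 0 r₁, ρ r < 1 ∧ Real.sinh r < 1 / 2 := fun r hr => hlt hr
  have hs₁ : 0 < Real.sinh r₁ := Real.sinh_pos_iff.2 hr₁'
  have hend : ρ r₁ < 1 ∧ Real.sinh r₁ < 1 / 2 := hbd r₁ ⟨hr₁', le_rfl⟩
  have hleft : ∀ u : ℝ → ℝ, Tendsto u (𝓝[>] 0) (𝓝 0) → ∀ r ∈ Ioc 0 r₁, 0 < u r →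
      ∃ a ∈ Ioc 0 r₁, a < r ∧ u a < u r := by
    intro u hu r hr hpos
    obtain ⟨a, ha1, ha2⟩ := ((hu.eventually (gt_mem_nhds hpos)).and
      (Ioo_mem_nhdsGT hr.1)).exists
    exact ⟨a, ⟨ha2.1, ha2.2.le.trans hr.2⟩, ha2.2, ha1⟩
  have hright : ∀ u : ℝ → ℝ, u r₁ ≤ 0 → ∀ r ∈ Ioc 0 r₁, 0 < u r →
      ∃ b ∈ Ioc 0 r₁, r < b ∧ u b < u r := by
    intro u hu r hr hpos
    refine ⟨r₁, ⟨hr₁', le_rfl⟩, lt_of_le_of_ne hr.2 ?_, by linarith⟩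
    rintro rfl
    linarith
  -- `κ sinh` matches `ρ` at `r₁`. It is a subsolution: for `u = sinh`, `sinh² u'' + cosh sinh u' -
  -- u = 2 sinh³ ≥ 0`, while for `ρ < 1` the same expression in `ρ` is nonpositive.
  set κ := ρ r₁ / Real.sinh r₁ with hκ
  have hκpos : 0 < κ := div_pos (hρ.pos hr₁') hs₁
  have lower : ∀ r ∈ Ioc 0 r₁, κ * Real.sinh r - ρ r ≤ 0 := by
    refine nonpos_of_convex_at_critical (u₁ := fun r => κ * Real.cosh r - deriv ρ r)
      (u₂ := fun r => κ * Real.sinh r - deriv (deriv ρ) r) ordConnected_Ioc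
      (fun r hr => ((Real.hasDerivAt_sinh r).const_mul κ).sub (hρ.hasDerivAt hr.1))
      (fun r hr => ((Real.hasDerivAt_cosh r).const_mul κ).sub (hρ.hasDerivAt_deriv hr.1))
      (hleft _ (by simpa using (hsinh0.const_mul κ).sub hρ.tendsto_zero))
      (hright _ (by rw [hκ, div_mul_cancel₀ _ hs₁.ne', sub_self])) ?_
    intro r hr hpos hcrit
    have hs : 0 < Real.sinh r := Real.sinh_pos_iff.2 hr.1
    have hode := hρ.sinh_sq_mul_deriv_deriv hr.1
    have hc := Real.cosh_sq r
    have hρ1 := (hbd r hr).1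
    have hρ0 := hρ.pos hr.1
    refine pos_of_mul_pos_right (b := κ * Real.sinh r - deriv (deriv ρ) r) ?_
      (sq_nonneg (Real.sinh r))
    have hid : Real.sinh r ^ 2 * (κ * Real.sinh r - deriv (deriv ρ) r)
        = (κ * Real.sinh r - ρ r) + 2 * κ * Real.sinh r ^ 3
          + 2 * Real.sinh r ^ 2 * (1 - ρ r ^ 2) * ρ r := by
      linear_combination -hode - Real.cosh r * Real.sinh r * hcrit
        + κ * Real.sinh r * hc
    rw [hid]
    have : 0 ≤ 1 - ρ r ^ 2 := by nlinarith
    positivity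
  -- With `s = sinh r`, the correction `-s³/2` makes the barrier a supersolution of `s² u'' + s cosh
  -- r u' = (1 - 2s²) u`, with defect `-7 K s⁵`. The factor `2` gives it the value `2 - sinh² r₁ > ρ
  -- r₁` at the end.
  set K := 2 / Real.sinh r₁ with hK
  have hKpos : 0 < K := by positivity
  have upper : ∀ r ∈ Ioc 0 r₁, ρ r - K * (Real.sinh r - Real.sinh r ^ 3 / 2) ≤ 0 := by
    refine nonpos_of_convex_at_critical
      (u₁ := fun r => deriv ρ r - K * (Real.cosh r - 3 / 2 * Real.sinh r ^ 2 * Real.cosh r))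
      (u₂ := fun r => deriv (deriv ρ) r - K * (Real.sinh r
        - 3 / 2 * (2 * Real.sinh r * Real.cosh r ^ 2 + Real.sinh r ^ 3))) ordConnected_Ioc
      (fun r hr => ?_) (fun r hr => ?_)
      (hleft _ ?_) (hright _ ?_) ?_
    · refine (hρ.hasDerivAt hr.1).sub (HasDerivAt.const_mul K ?_)
      exact ((Real.hasDerivAt_sinh r).sub (((Real.hasDerivAt_sinh r).pow 3).div_const 2)).congr_deriv
        (by push_cast; ring)
    · refine (hρ.hasDerivAt_deriv hr.1).sub (HasDerivAt.const_mul K ?_)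
      exact ((Real.hasDerivAt_cosh r).sub ((((Real.hasDerivAt_sinh r).pow 2).const_mul (3 / 2)).mul
        (Real.hasDerivAt_cosh r))).congr_deriv (by simp only [Pi.pow_apply]; push_cast; ring)
    · have := hρ.tendsto_zero.sub ((hsinh0.sub ((hsinh0.pow 3).div_const 2)).const_mul K)
      simpa using this
    · have : K * (Real.sinh r₁ - Real.sinh r₁ ^ 3 / 2) = 2 - Real.sinh r₁ ^ 2 := by
        rw [hK]; field_simp
      rw [this]
      nlinarith
    · intro r hr hpos hcrit
      have hs : 0 < Real.sinh r := Real.sinh_pos_iff.2 hr.1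
      have hode := hρ.sinh_sq_mul_deriv_deriv hr.1
      have hc := Real.cosh_sq r
      obtain ⟨hρ1, hs1⟩ := hbd r hr
      have hρ0 := hρ.pos hr.1
      refine pos_of_mul_pos_right (a := Real.sinh r ^ 2) ?_ (sq_nonneg (Real.sinh r))
      set s := Real.sinh r
      set c := Real.cosh r
      have hid : s ^ 2 * (deriv (deriv ρ) r - K * (s - 3 / 2 * (2 * s * c ^ 2 + s ^ 3)))
          = (1 - 2 * s ^ 2) * (ρ r - K * (s - s ^ 3 / 2)) + 2 * s ^ 2 * ρ r ^ 3
            + 7 * K * s ^ 5 := by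
        linear_combination hode - c * s * hcrit + K * s * (9 / 2 * s ^ 2 - 1) * hc
      rw [hid]
      have : 0 < 1 - 2 * s ^ 2 := by nlinarith
      positivity
  refine ⟨r₁, κ, K, hr₁', hκpos, hKpos, fun r hr => ⟨by linarith [lower r hr], ?_⟩⟩
  have hs : 0 < Real.sinh r := Real.sinh_pos_iff.2 hr.1
  have h1 := upper r hr
  have h2 : 0 < K * Real.sinh r ^ 3 := by positivity
  linarith

end IsVortexProfile

/-! ### The real eigenvalue system and decay of its square-integrable solutions. -/

/-- An `L²` function on a half-line with second derivative in `L²` decays along with its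
derivative. -/
theorem tendsto_zero_of_sq_integrable {u u₁ u₂ : ℝ → ℝ} {a : ℝ}
    (hu : ∀ r, a ≤ r → HasDerivAt u (u₁ r) r) (hu₁ : ∀ r, a ≤ r → HasDerivAt u₁ (u₂ r) r)
    (hc : ContinuousOn u₂ (Ici a))
    (iu : IntegrableOn (fun r => u r ^ 2) (Ioi a)) (iu₂ : IntegrableOn (fun r => u₂ r ^ 2) (Ioi a)) :
    Tendsto u atTop (𝓝 0) ∧ Tendsto u₁ atTop (𝓝 0) := by
  have cu : ContinuousOn u (Ici a) := fun r hr => (hu r hr).continuousAt.continuousWithinAt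
  have cu₁ : ContinuousOn u₁ (Ici a) := fun r hr => (hu₁ r hr).continuousAt.continuousWithinAt
  have mul_int : ∀ f g : ℝ → ℝ, ContinuousOn f (Ici a) → ContinuousOn g (Ici a) →
      IntegrableOn (fun r => f r ^ 2) (Ioi a) → IntegrableOn (fun r => g r ^ 2) (Ioi a) →
      IntegrableOn (fun r => f r * g r) (Ioi a) := by
    intro f g hf hg i1 i2
    refine (i1.add i2).mono'
      (((hf.mul hg).mono Ioi_subset_Ici_self).aestronglyMeasurable measurableSet_Ioi) ?_
    refine ae_of_all _ fun r => ?_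
    rw [Real.norm_eq_abs, abs_mul, Pi.add_apply]
    nlinarith [sq_nonneg (|f r| - |g r|), sq_abs (f r), sq_abs (g r), sq_nonneg (f r),
      sq_nonneg (g r)]
  have iuu₂ := mul_int u u₂ cu hc iu iu₂
  set C := |u a * u₁ a| + ∫ r in Ioi a, |u r * u₂ r| with hC
  -- Integrating `(u u')' = u'² + u u''` reduces `u' ∈ L²` to bounding `u u'` along a sequence
  -- tending to infinity.
  have hparts : ∀ b, a ≤ b → ∫ r in a..b, u₁ r ^ 2 ≤ u b * u₁ b + C := by
    intro b hab
    have hsub : uIcc a b ⊆ Ici a := by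
      rw [uIcc_of_le hab]
      exact Icc_subset_Ici_self
    have i1 : IntervalIntegrable (fun r => u₁ r ^ 2) volume a b :=
      ((cu₁.pow 2).mono hsub).intervalIntegrable
    have i2 : IntervalIntegrable (fun r => u r * u₂ r) volume a b :=
      ((cu.mul hc).mono hsub).intervalIntegrable
    have hftc := intervalIntegral.integral_eq_sub_of_hasDerivAt (f := fun r => u r * u₁ r)
      (f' := fun r => u₁ r ^ 2 + u r * u₂ r) (a := a) (b := b)
      (fun r hr => ((hu r (hsub hr)).mul (hu₁ r (hsub hr))).congr_deriv (by ring)) (i1.add i2)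
    rw [intervalIntegral.integral_add i1 i2] at hftc
    have h3 : |∫ r in a..b, u r * u₂ r| ≤ ∫ r in Ioi a, |u r * u₂ r| := by
      refine (intervalIntegral.abs_integral_le_integral_abs hab).trans ?_
      rw [intervalIntegral.integral_of_le hab]
      exact setIntegral_mono_set iuu₂.abs (ae_of_all _ fun r => abs_nonneg _)
        Ioc_subset_Ioi_self.eventuallyLE
    have := (abs_le.1 h3).1
    have := neg_abs_le (u a * u₁ a)
    simp only [hC]
    linarith
  -- Otherwise `(u²)' > 2` eventually, so `u²` grows linearly and is not integrable.
  have hfreq : ∀ N : ℝ, ∃ b, N ≤ b ∧ a ≤ b ∧ u b * u₁ b ≤ 1 := by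
    intro N
    by_contra! hcon
    set M := max N a with hM
    have hmono : ∀ b, M ≤ b → u M ^ 2 + 2 * (b - M) ≤ u b ^ 2 := by
      intro b hb
      have hmon : MonotoneOn (fun r => u r ^ 2 - 2 * r) (Ici M) := by
        have hd : ∀ r ∈ Ici M, HasDerivAt (fun r => u r ^ 2 - 2 * r) (2 * (u r * u₁ r) - 2) r := by
          intro r hr
          exact (((hu r ((le_max_right N a).trans hr)).pow 2).sub
            ((hasDerivAt_id r).const_mul 2)).congr_deriv (by push_cast; ring)
        refine monotoneOn_of_hasDerivWithinAt_nonneg (convex_Ici M)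
          (fun r hr => (hd r hr).continuousAt.continuousWithinAt)
          (fun r hr => (hd r (interior_subset hr)).hasDerivWithinAt) fun r hr => ?_
        have hr' : M ≤ r := interior_subset hr
        have := hcon r ((le_max_left N a).trans hr') ((le_max_right N a).trans hr')
        linarith
      have := hmon self_mem_Ici hb hb
      simp only at this
      linarith
    have hI : IntegrableOn (fun _ : ℝ => (1 : ℝ)) (Ioi (M + 1)) := by
      refine (iu.mono_set (Ioi_subset_Ioi (by linarith [le_max_right N a]))).mono'
        aestronglyMeasurable_const ((ae_restrict_iff' measurableSet_Ioi).2
          (ae_of_all _ fun r hr => ?_))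
      have hr' : M + 1 < r := hr
      have := hmono r (by linarith)
      rw [norm_one]
      nlinarith [sq_nonneg (u M)]
    rw [integrableOn_const_iff] at hI
    simp at hI
  choose b hb1 hb2 hb3 using fun n : ℕ => hfreq n
  have iu₁ : IntegrableOn (fun r => u₁ r ^ 2) (Ioi a) := by
    refine integrableOn_Ioi_of_intervalIntegral_norm_bounded (l := atTop) (b := b) (1 + C) a
      (fun n => ?_) (tendsto_atTop_mono hb1 tendsto_natCast_atTop_atTop)
      (Eventually.of_forall fun n => ?_)
    · exact ((cu₁.pow 2).mono Icc_subset_Ici_self).integrableOn_Icc.mono_set Ioc_subset_Icc_self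
    · have : ∀ r, ‖u₁ r ^ 2‖ = u₁ r ^ 2 := fun r => by
        rw [Real.norm_eq_abs, abs_of_nonneg (sq_nonneg _)]
      simp only [this]
      linarith [hparts (b n) (hb2 n), hb3 n]
  have sq_lim : ∀ f f' : ℝ → ℝ, (∀ r, a ≤ r → HasDerivAt f (f' r) r) →
      IntegrableOn (fun r => f r ^ 2) (Ioi a) → IntegrableOn (fun r => f r * f' r) (Ioi a) →
      Tendsto f atTop (𝓝 0) := by
    intro f f' hf i1 i2
    -- `f²` and its derivative `2 f f'` are both integrable, which forces `f² → 0`.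
    have := tendsto_zero_of_hasDerivAt_of_integrableOn_Ioi (f := fun r => f r ^ 2)
      (f' := fun r => 2 * (f r * f' r)) (a := a)
      (fun r hr => ((hf r (mem_Ioi.1 hr).le).pow 2).congr_deriv (by push_cast; ring))
      (i2.const_mul 2) i1
    have h2 := this.sqrt
    simp only [Real.sqrt_sq_eq_abs, Real.sqrt_zero] at h2
    exact (tendsto_zero_iff_abs_tendsto_zero f).2 h2
  exact ⟨sq_lim u u₁ hu iu (mul_int u u₁ cu cu₁ iu iu₁),
    sq_lim u₁ u₂ hu₁ iu₁ (mul_int u₁ u₂ cu₁ hc iu₁ iu₂)⟩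

/-- The potential of `𝔏₁`. -/
noncomputable def potential₁ (ρ : ℝ → ℝ) (r : ℝ) : ℝ := freePotential r + (ρ r ^ 2 - 1)

/-- The potential of `𝔏₂`. -/
noncomputable def potential₂ (ρ : ℝ → ℝ) (r : ℝ) : ℝ := freePotential r + (3 * ρ r ^ 2 - 1)

theorem continuousOn_freePotential : ContinuousOn freePotential (Ioi 0) := by
  have : freePotential = fun r => 3 / 8 * (1 / Real.sinh r ^ 2) + 1 / 8 := by
    funext r
    rw [freePotential]
    ring
  rw [this]
  exact (continuousOn_const.mul continuousOn_inv_sinh_sq).add continuousOn_const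

/-- A real solution of the eigenvalue system `𝔏₁ y = -lam φ`, `𝔏₂ φ = -lam y`. -/
structure IsSolution (ρ : ℝ → ℝ) (lam : ℝ) (y y₁ φ φ₁ : ℝ → ℝ) : Prop where
  hy : ∀ r, 0 < r → HasDerivAt y (y₁ r) r
  hy₁ : ∀ r, 0 < r → HasDerivAt y₁ (2 * (potential₁ ρ r * y r + lam * φ r)) r
  hφ : ∀ r, 0 < r → HasDerivAt φ (φ₁ r) r
  hφ₁ : ∀ r, 0 < r → HasDerivAt φ₁ (2 * (potential₂ ρ r * φ r + lam * y r)) r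

namespace IsVortexProfile

variable {ρ : ℝ → ℝ}

theorem continuousOn_potential₁ (hρ : IsVortexProfile ρ) : ContinuousOn (potential₁ ρ) (Ioi 0) :=
  continuousOn_freePotential.add ((hρ.continuousOn.pow 2).sub continuousOn_const)

theorem continuousOn_potential₂ (hρ : IsVortexProfile ρ) : ContinuousOn (potential₂ ρ) (Ioi 0) :=
  continuousOn_freePotential.add
    ((continuousOn_const.mul (hρ.continuousOn.pow 2)).sub continuousOn_const)

/-- Both potentials converge exponentially fast. -/
theorem exists_abs_potential_sub_le (hρ : IsVortexProfile ρ) :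
    ∃ R C : ℝ, 1 ≤ R ∧ 0 ≤ C ∧ ∀ r, R ≤ r → |potential₁ ρ r - 1 / 8| ≤ C * Real.exp (-r) ∧
      |potential₂ ρ r - 17 / 8| ≤ C * Real.exp (-r) := by
  obtain ⟨R, K, hR, hK, h⟩ := hρ.exists_abs_one_sub_le
  refine ⟨R, 6 + 9 * K, hR, by positivity, fun r hr => ?_⟩
  obtain ⟨h2, h3⟩ := h r hr
  have hr0 : 0 < r := by linarith
  have hpos := hρ.pos hr0
  have hs : 0 < Real.sinh r := Real.sinh_pos_iff.2 hr0
  have h4 : |ρ r ^ 2 - 1| ≤ 3 * (K * Real.exp (-r)) := by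
    have : ρ r ^ 2 - 1 = -((1 + ρ r) * (1 - ρ r)) := by ring
    rw [this, abs_neg, abs_mul, abs_of_pos (by linarith)]
    gcongr
    linarith
  have h5 : |3 / (8 * Real.sinh r ^ 2)| ≤ 6 * Real.exp (-r) := by
    rw [abs_of_pos (by positivity)]
    have := inv_sinh_sq_le (hR.trans hr)
    have h6 : 3 / (8 * Real.sinh r ^ 2) = 3 / 8 * (1 / Real.sinh r ^ 2) := by
      field_simp
    rw [h6]
    linarith
  have he := Real.exp_pos (-r)
  have hKe : 0 ≤ K * Real.exp (-r) := by positivity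
  rw [abs_le] at h4 h5
  simp only [potential₁, potential₂, freePotential, abs_le]
  refine ⟨⟨?_, ?_⟩, ⟨?_, ?_⟩⟩ <;> linarith

end IsVortexProfile

namespace IsSolution

variable {ρ y y₁ φ φ₁ : ℝ → ℝ} {lam : ℝ}

theorem neg (h : IsSolution ρ lam y y₁ φ φ₁) : IsSolution ρ lam (-y) (-y₁) (-φ) (-φ₁) where
  hy r hr := (h.hy r hr).neg
  hy₁ r hr := (h.hy₁ r hr).neg.congr_deriv (by simp only [Pi.neg_apply]; ring)
  hφ r hr := (h.hφ r hr).neg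
  hφ₁ r hr := (h.hφ₁ r hr).neg.congr_deriv (by simp only [Pi.neg_apply]; ring)

theorem eq_zero (hρ : IsVortexProfile ρ) (h : IsSolution ρ lam y y₁ φ φ₁) {r₀ : ℝ} (hr₀ : 0 < r₀)
    (h1 : y r₀ = 0) (h2 : y₁ r₀ = 0) (h3 : φ r₀ = 0) (h4 : φ₁ r₀ = 0) :
    ∀ r, 0 < r → y r = 0 ∧ φ r = 0 := by
  have hall := eq_zero_of_abs_deriv_le
    (N := fun t => y t ^ 2 + y₁ t ^ 2 + φ t ^ 2 + φ₁ t ^ 2)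
    (N' := fun t => 2 * (y t * y₁ t) * (1 + 2 * potential₁ ρ t)
      + 2 * (φ t * φ₁ t) * (1 + 2 * potential₂ ρ t)
      + 2 * (φ t * y₁ t) * (2 * lam) + 2 * (y t * φ₁ t) * (2 * lam))
    (K := fun t => |1 + 2 * potential₁ ρ t| + |1 + 2 * potential₂ ρ t| + |2 * lam| + |2 * lam|)
    (r₀ := r₀)
    (fun t ht => (((((h.hy t ht).pow 2).add ((h.hy₁ t ht).pow 2)).add ((h.hφ t ht).pow 2)).add
      ((h.hφ₁ t ht).pow 2)).congr_deriv (by push_cast; ring)) ?_ ?_ (fun t _ => by positivity) hr₀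
    (by simp [h1, h2, h3, h4])
  · intro r hr
    have := hall r hr
    constructor <;> refine pow_eq_zero_iff two_ne_zero |>.1 ?_ <;>
      nlinarith [sq_nonneg (y r), sq_nonneg (y₁ r), sq_nonneg (φ r), sq_nonneg (φ₁ r)]
  · have c1 : ContinuousOn (fun t => |1 + 2 * potential₁ ρ t|) (Ioi 0) :=
      (continuousOn_const.add (continuousOn_const.mul hρ.continuousOn_potential₁)).abs
    have c2 : ContinuousOn (fun t => |1 + 2 * potential₂ ρ t|) (Ioi 0) :=
      (continuousOn_const.add (continuousOn_const.mul hρ.continuousOn_potential₂)).abs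
    exact ((c1.add c2).add continuousOn_const).add continuousOn_const
  · intro t _
    have key : ∀ a b c N : ℝ, a ^ 2 + b ^ 2 ≤ N → |2 * (a * b) * c| ≤ |c| * N := by
      intro a b c N hN
      rw [abs_mul, mul_comm]
      refine mul_le_mul_of_nonneg_left (le_trans ?_ hN) (abs_nonneg c)
      rw [abs_le]
      constructor <;> nlinarith [sq_nonneg (a - b), sq_nonneg (a + b)]
    refine (abs_add_le _ _).trans ?_
    refine (add_le_add_left (abs_add_three _ _ _) _).trans ?_
    have q1 := sq_nonneg (y t)
    have q2 := sq_nonneg (y₁ t)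
    have q3 := sq_nonneg (φ t)
    have q4 := sq_nonneg (φ₁ t)
    set N := y t ^ 2 + y₁ t ^ 2 + φ t ^ 2 + φ₁ t ^ 2 with hN
    have k1 := key (y t) (y₁ t) (1 + 2 * potential₁ ρ t) N (by linarith)
    have k2 := key (φ t) (φ₁ t) (1 + 2 * potential₂ ρ t) N (by linarith)
    have k3 := key (φ t) (y₁ t) (2 * lam) N (by linarith)
    have k4 := key (y t) (φ₁ t) (2 * lam) N (by linarith)
    linarith

/-- Square-integrable solutions decay at infinity along with their derivatives. -/
theorem tendsto_zero (hρ : IsVortexProfile ρ) (h : IsSolution ρ lam y y₁ φ φ₁)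
    (iy : IntegrableOn (fun r => y r ^ 2) (Ioi 0)) (iφ : IntegrableOn (fun r => φ r ^ 2) (Ioi 0)) :
    (Tendsto y atTop (𝓝 0) ∧ Tendsto y₁ atTop (𝓝 0)) ∧
      (Tendsto φ atTop (𝓝 0) ∧ Tendsto φ₁ atTop (𝓝 0)) := by
  obtain ⟨R, C, hR, hC, hpot⟩ := hρ.exists_abs_potential_sub_le
  have hsub : Ici R ⊆ Ioi (0 : ℝ) := fun r hr => by
    have : R ≤ r := hr
    exact mem_Ioi.2 (by linarith)
  have cy : ContinuousOn y (Ici R) := fun r hr =>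
    (h.hy r (hsub hr)).continuousAt.continuousWithinAt
  have cφ : ContinuousOn φ (Ici R) := fun r hr =>
    (h.hφ r (hsub hr)).continuousAt.continuousWithinAt
  have c1 := hρ.continuousOn_potential₁.mono hsub
  have c2 := hρ.continuousOn_potential₂.mono hsub
  have jy := iy.mono_set (Ioi_subset_Ici_self.trans hsub)
  have jφ := iφ.mono_set (Ioi_subset_Ici_self.trans hsub)
  have main : ∀ V f g : ℝ → ℝ, ContinuousOn V (Ici R) → ContinuousOn f (Ici R) →
      ContinuousOn g (Ici R) → IntegrableOn (fun r => f r ^ 2) (Ioi R) →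
      IntegrableOn (fun r => g r ^ 2) (Ioi R) → (∀ r, R ≤ r → |V r| ≤ 17 / 8 + C) →
      ContinuousOn (fun r => 2 * (V r * f r + lam * g r)) (Ici R) ∧
      IntegrableOn (fun r => (2 * (V r * f r + lam * g r)) ^ 2) (Ioi R) := by
    intro V f g cV cf cg jf jg hV
    have hcont : ContinuousOn (fun r => 2 * (V r * f r + lam * g r)) (Ici R) :=
      continuousOn_const.mul ((cV.mul cf).add (continuousOn_const.mul cg))
    refine ⟨hcont, ((jf.const_mul (8 * (17 / 8 + C) ^ 2)).add (jg.const_mul (8 * lam ^ 2))).mono'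
      (((hcont.pow 2).mono Ioi_subset_Ici_self).aestronglyMeasurable measurableSet_Ioi)
      ((ae_restrict_iff' measurableSet_Ioi).2 (ae_of_all _ fun r hr => ?_))⟩
    have hVr : V r ^ 2 ≤ (17 / 8 + C) ^ 2 := by
      have := hV r (mem_Ioi.1 hr).le
      rw [← sq_abs]
      gcongr
    rw [Real.norm_eq_abs, abs_of_nonneg (sq_nonneg _), Pi.add_apply]
    have := mul_le_mul_of_nonneg_right hVr (sq_nonneg (f r))
    nlinarith [sq_nonneg (V r * f r - lam * g r)]
  have hbound : ∀ r, R ≤ r → |potential₁ ρ r| ≤ 17 / 8 + C ∧ |potential₂ ρ r| ≤ 17 / 8 + C := by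
    intro r hr
    obtain ⟨p1, p2⟩ := hpot r hr
    have he : C * Real.exp (-r) ≤ C :=
      mul_le_of_le_one_right hC (Real.exp_le_one_iff.2 (by linarith))
    rw [abs_le] at p1 p2 ⊢
    rw [abs_le]
    refine ⟨⟨?_, ?_⟩, ⟨?_, ?_⟩⟩ <;> linarith
  obtain ⟨a1, a2⟩ := main _ y φ c1 cy cφ jy jφ fun r hr => (hbound r hr).1
  obtain ⟨b1, b2⟩ := main _ φ y c2 cφ cy jφ jy fun r hr => (hbound r hr).2
  exact ⟨tendsto_zero_of_sq_integrable (fun r hr => h.hy r (hsub hr))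
      (fun r hr => h.hy₁ r (hsub hr)) a1 jy a2,
    tendsto_zero_of_sq_integrable (fun r hr => h.hφ r (hsub hr))
      (fun r hr => h.hφ₁ r (hsub hr)) b1 jφ b2⟩

end IsSolution

/-! ### Sturm comparison and the zero mode of `𝔏₁`. -/

/-- Sturm comparison to the left of a point where the Wronskian is nonpositive. -/
theorem pos_of_wronskian_nonpos {u u₁ u₂ f f₁ f₂ : ℝ → ℝ} {a b : ℝ} (hab : a ≤ b)
    (hu : ∀ r ∈ Icc a b, HasDerivAt u (u₁ r) r) (hu₁ : ∀ r ∈ Icc a b, HasDerivAt u₁ (u₂ r) r)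
    (hf : ∀ r ∈ Icc a b, HasDerivAt f (f₁ r) r) (hf₁ : ∀ r ∈ Icc a b, HasDerivAt f₁ (f₂ r) r)
    (hfpos : ∀ r ∈ Icc a b, 0 < f r) (hW : ∀ r ∈ Ioo a b, 0 ≤ u₂ r * f r - u r * f₂ r)
    (hub : 0 < u b) (hWb : u₁ b * f b - u b * f₁ b ≤ 0) :
    0 < u a ∧ u₁ a * f a - u a * f₁ a ≤ u₁ b * f b - u b * f₁ b := by
  have hdW : ∀ r ∈ Icc a b, HasDerivAt (fun r => u₁ r * f r - u r * f₁ r)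
      (u₂ r * f r - u r * f₂ r) r := fun r hr =>
    (((hu₁ r hr).mul (hf r hr)).sub ((hu r hr).mul (hf₁ r hr))).congr_deriv (by ring)
  have hmono : MonotoneOn (fun r => u₁ r * f r - u r * f₁ r) (Icc a b) := by
    refine monotoneOn_of_hasDerivWithinAt_nonneg (convex_Icc a b)
      (fun r hr => (hdW r hr).continuousAt.continuousWithinAt)
      (fun r hr => (hdW r (interior_subset hr)).hasDerivWithinAt) fun r hr => ?_
    rw [interior_Icc] at hr
    exact hW r hr
  have hWle : ∀ r ∈ Icc a b, u₁ r * f r - u r * f₁ r ≤ u₁ b * f b - u b * f₁ b := fun r hr =>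
    hmono hr (right_mem_Icc.2 hab) hr.2
  have hdq : ∀ r ∈ Icc a b, HasDerivAt (fun r => u r / f r)
      ((u₁ r * f r - u r * f₁ r) / f r ^ 2) r := fun r hr =>
    (hu r hr).div (hf r hr) (hfpos r hr).ne'
  -- `(u/f)' = W/f²`, and the nondecreasing Wronskian `W` is nonpositive on the whole interval.
  have hanti : AntitoneOn (fun r => u r / f r) (Icc a b) := by
    refine antitoneOn_of_hasDerivWithinAt_nonpos (convex_Icc a b)
      (fun r hr => (hdq r hr).continuousAt.continuousWithinAt)
      (fun r hr => (hdq r (interior_subset hr)).hasDerivWithinAt) fun r hr => ?_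
    exact div_nonpos_of_nonpos_of_nonneg ((hWle r (interior_subset hr)).trans hWb) (sq_nonneg _)
  have ha := left_mem_Icc.2 hab
  have h1 : 0 < u a / f a :=
    (div_pos hub (hfpos b (right_mem_Icc.2 hab))).trans_le (hanti ha (right_mem_Icc.2 hab) hab)
  exact ⟨(div_pos_iff_of_pos_right (hfpos a ha)).1 h1, hWle a ha⟩

/-- The zero mode `√(sinh r) ρ(r)` of the differential expression `𝔏₁`. -/
noncomputable def zeroMode (ρ : ℝ → ℝ) (r : ℝ) : ℝ := √(Real.sinh r) * ρ r

/-- The derivative of `zeroMode`. -/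
noncomputable def zeroModeDeriv (ρ : ℝ → ℝ) (r : ℝ) : ℝ :=
  √(Real.sinh r) * deriv ρ r + Real.cosh r / (2 * √(Real.sinh r)) * ρ r

namespace IsVortexProfile

variable {ρ : ℝ → ℝ}

theorem zeroMode_pos (hρ : IsVortexProfile ρ) {r : ℝ} (hr : 0 < r) : 0 < zeroMode ρ r :=
  mul_pos (Real.sqrt_pos.2 (Real.sinh_pos_iff.2 hr)) (hρ.pos hr)

theorem hasDerivAt_zeroMode (hρ : IsVortexProfile ρ) {r : ℝ} (hr : 0 < r) :
    HasDerivAt (zeroMode ρ) (zeroModeDeriv ρ r) r :=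
  (((Real.hasDerivAt_sinh r).sqrt (Real.sinh_pos_iff.2 hr).ne').mul
    (hρ.hasDerivAt hr)).congr_deriv (by rw [zeroModeDeriv]; ring)

/-- The factor `√(sinh r)` removes the first-order term of the radial Laplacian, so the vortex
equation itself becomes `𝔏₁ f = 0`. -/
theorem hasDerivAt_zeroModeDeriv (hρ : IsVortexProfile ρ) {r : ℝ} (hr : 0 < r) :
    HasDerivAt (zeroModeDeriv ρ) (2 * potential₁ ρ r * zeroMode ρ r) r := by
  have hs : 0 < Real.sinh r := Real.sinh_pos_iff.2 hr
  have hg : 0 < √(Real.sinh r) := Real.sqrt_pos.2 hs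
  have hd := (Real.hasDerivAt_sinh r).sqrt hs.ne'
  have h := (hd.mul (hρ.hasDerivAt_deriv hr)).add
    (((Real.hasDerivAt_cosh r).div (hd.const_mul 2) (by positivity)).mul (hρ.hasDerivAt hr))
  refine h.congr_deriv ?_
  rw [hρ.deriv_deriv_eq hr, potential₁, freePotential, zeroMode]
  simp only [Pi.div_apply]
  have hsq : Real.sinh r = √(Real.sinh r) ^ 2 := (Real.sq_sqrt hs.le).symm
  have hc := Real.cosh_sq r
  generalize √(Real.sinh r) = g at hg hsq ⊢
  rw [hsq] at hc ⊢
  generalize Real.cosh r = c at hc ⊢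
  generalize deriv ρ r = z
  generalize ρ r = x
  field_simp
  ring_nf
  have hc4 : c ^ 2 = 1 + g ^ 4 := by linear_combination hc
  simp only [hc4]
  ring

/-- Needed so that `u > 0` and `u' ≤ -u` give `u' f - u f' ≤ -u (f + f') < 0`. It suffices that
eventually `ρ' ≥ -1/2` and `ρ > 1/2`. The former comes from `sinh r ρ'`, whose derivative is free of
`ρ'` by the equation and exceeds `-sinh r / 4` once `2ρ(1 - ρ²) < 1/4`. -/
theorem eventually_zeroModeDeriv_add_pos (hρ : IsVortexProfile ρ) :
    ∀ᶠ r in atTop, 0 < zeroModeDeriv ρ r + zeroMode ρ r := by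
  have hlim : Tendsto (fun r => 2 * ρ r * (1 - ρ r ^ 2)) atTop (𝓝 0) := by
    have := (hρ.tendsto_one.const_mul 2).mul ((hρ.tendsto_one.pow 2).const_sub 1)
    simpa using this
  obtain ⟨R, hR⟩ := eventually_atTop.1
    ((hlim.eventually (gt_mem_nhds (show (0 : ℝ) < 1 / 4 by norm_num))).and
      ((hρ.tendsto_one.eventually (lt_mem_nhds one_half_lt_one)).and (eventually_ge_atTop 1)))
  have hR1 : 1 ≤ R := (hR R le_rfl).2.2
  have hmono : MonotoneOn (fun r => Real.sinh r * deriv ρ r + Real.cosh r / 4) (Ici R) := by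
    have hd : ∀ r ∈ Ici R, HasDerivAt (fun r => Real.sinh r * deriv ρ r + Real.cosh r / 4)
        (Real.cosh r * deriv ρ r + Real.sinh r * deriv (deriv ρ) r + Real.sinh r / 4) r := by
      intro r hr
      have hr0 : 0 < r := by linarith [mem_Ici.1 hr]
      exact ((Real.hasDerivAt_sinh r).mul (hρ.hasDerivAt_deriv hr0)).add
        ((Real.hasDerivAt_cosh r).div_const 4)
    refine monotoneOn_of_hasDerivWithinAt_nonneg (convex_Ici R)
      (fun r hr => (hd r hr).continuousAt.continuousWithinAt)
      (fun r hr => (hd r (interior_subset hr)).hasDerivWithinAt) fun r hr => ?_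
    have hrR : R ≤ r := interior_subset hr
    have hr0 : 0 < r := by linarith
    have hs : 0 < Real.sinh r := Real.sinh_pos_iff.2 hr0
    have hρ0 := hρ.pos hr0
    have h1 := (hR r hrR).1
    have hid : Real.cosh r * deriv ρ r + Real.sinh r * deriv (deriv ρ) r + Real.sinh r / 4
        = ρ r / Real.sinh r + Real.sinh r * (1 / 4 - 2 * ρ r * (1 - ρ r ^ 2)) := by
      rw [hρ.deriv_deriv_eq hr0]
      field_simp
      ring
    rw [hid]
    have : 0 ≤ 1 / 4 - 2 * ρ r * (1 - ρ r ^ 2) := by linarith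
    positivity
  set K := Real.sinh R * deriv ρ R + Real.cosh R / 4
  filter_upwards [eventually_ge_atTop R, eventually_ge_atTop (1 - 4 * K)] with r hrR hrK
  have hr0 : 0 < r := by linarith
  have hs : 0 < Real.sinh r := Real.sinh_pos_iff.2 hr0
  have hg : 0 < √(Real.sinh r) := Real.sqrt_pos.2 hs
  have h1 : K ≤ Real.sinh r * deriv ρ r + Real.cosh r / 4 := hmono self_mem_Ici hrR hrR
  have h2 : Real.cosh r ≤ Real.sinh r + 1 := by
    have := Real.cosh_sub_sinh r
    have : Real.exp (-r) ≤ 1 := Real.exp_le_one_iff.2 (by linarith)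
    linarith
  have h3 : r ≤ Real.sinh r := Real.self_le_sinh_iff.2 hr0.le
  have h4 : -(1 / 2) ≤ deriv ρ r := by
    refine le_of_mul_le_mul_left ?_ hs
    linarith
  have h5 := (hR r hrR).2.1
  have h6 : 0 < √(Real.sinh r) * (deriv ρ r + ρ r) := mul_pos hg (by linarith)
  have h7 : 0 < Real.cosh r / (2 * √(Real.sinh r)) * ρ r := by
    have := Real.cosh_pos r
    have := hρ.pos hr0
    positivity
  rw [zeroModeDeriv, zeroMode]
  linarith

end IsVortexProfile

/-! ### Signs far out and their propagation to the left. -/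

namespace IsSolution

variable {ρ y y₁ φ φ₁ : ℝ → ℝ} {lam : ℝ}

/-- Beyond the threshold, a square-integrable solution is arbitrarily far out dominated by the
exponentially decaying mode, along which `y` and `φ` have the same sign. -/
theorem eq_zero_or_exists_signs (hρ : IsVortexProfile ρ) (h : IsSolution ρ lam y y₁ φ φ₁)
    (hlam : √17 / 8 ≤ lam)
    (iy : IntegrableOn (fun r => y r ^ 2) (Ioi 0)) (iφ : IntegrableOn (fun r => φ r ^ 2) (Ioi 0))
    (R : ℝ) : (∀ r, 0 < r → y r = 0 ∧ φ r = 0) ∨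
      ∃ σ r, R ≤ r ∧ 0 < r ∧ (σ = 1 ∨ σ = -1) ∧ 0 < σ * y r ∧ 0 < σ * φ r ∧
        σ * y₁ r ≤ -(σ * y r) ∧ σ * φ₁ r ≤ -(σ * φ r) := by
  obtain ⟨⟨y0, y0'⟩, φ0, φ0'⟩ := h.tendsto_zero hρ iy iφ
  obtain ⟨R', C, hR', hC, hpot⟩ := hρ.exists_abs_potential_sub_le
  have hlam0 : 0 < lam := lt_of_lt_of_le (by positivity) hlam
  have hlam2 : 17 / 64 ≤ lam ^ 2 := by
    have h17 : √17 ^ 2 = 17 := Real.sq_sqrt (by norm_num)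
    have : 0 ≤ √17 := Real.sqrt_nonneg _
    nlinarith
  set S := √(1 + lam ^ 2) with hS
  have hSsq : S ^ 2 = 1 + lam ^ 2 := Real.sq_sqrt (by positivity)
  -- This is where the threshold enters: it makes `w = 2 (S - 9/8)` nonnegative, so the mode `p`
  -- does not decay on its own.
  have hS98 : 9 / 8 ≤ S := Real.le_sqrt_of_sq_le (by linarith)
  have hSlam : lam < S := by nlinarith
  set k := √(2 * (S + 9 / 8)) with hk
  have hksq : k ^ 2 = 2 * (S + 9 / 8) := Real.sq_sqrt (by linarith)
  have hk2 : 2 ≤ k := Real.le_sqrt_of_sq_le (by linarith)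
  set D := lam ^ 2 + (1 + S) ^ 2 with hD
  have hDpos : 0 < D := by positivity
  -- Chosen so that `(1 + S) |p| ≤ lam |q| / 4`: in `D y = lam q - (1 + S) p` the `q` term then
  -- fixes the sign, and `k ≥ 2` leaves room for `y' ≤ -y`.
  set θ := lam / (4 * (1 + S)) with hθ
  have hθpos : 0 < θ := by positivity
  have hθS : (1 + S) * θ = lam / 4 := by rw [hθ]; field_simp
  have hθ1 : θ ≤ 1 / 4 := by nlinarith
  -- `p` and `q` diagonalize the limiting matrix, with eigenvalues `2 (9/8 - S)` and `2 (9/8 + S) =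
  -- k²`.
  set p : ℝ → ℝ := fun r => lam * φ r - (1 + S) * y r with hp
  set q : ℝ → ℝ := fun r => lam * y r + (1 + S) * φ r with hq
  set p₁ : ℝ → ℝ := fun r => lam * φ₁ r - (1 + S) * y₁ r with hp₁
  set q₁ : ℝ → ℝ := fun r => lam * y₁ r + (1 + S) * φ₁ r with hq₁
  have ey : ∀ r, D * y r = lam * q r - (1 + S) * p r := fun r => by simp only [hp, hq, hD]; ring
  have eφ : ∀ r, D * φ r = (1 + S) * q r + lam * p r := fun r => by simp only [hp, hq, hD]; ring
  have ey₁ : ∀ r, D * y₁ r = lam * q₁ r - (1 + S) * p₁ r := fun r => by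
    simp only [hp₁, hq₁, hD]; ring
  have eφ₁ : ∀ r, D * φ₁ r = (1 + S) * q₁ r + lam * p₁ r := fun r => by
    simp only [hp₁, hq₁, hD]; ring
  have hcomb : ∀ a b A B : ℝ, |a| ≤ 1 + S → |b| ≤ 1 + S → |a * A + b * B| ≤ D * (|A| + |B|) := by
    intro a b A B ha hb
    have hDS : 1 + S ≤ D := by nlinarith
    calc |a * A + b * B| ≤ |a * A| + |b * B| := abs_add_le _ _
      _ = |a| * |A| + |b| * |B| := by rw [abs_mul, abs_mul]
      _ ≤ D * |A| + D * |B| := by gcongr <;> linarith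
      _ = _ := by ring
  have hSabs : |1 + S| = 1 + S := abs_of_pos (by linarith)
  have hlabs : |lam| ≤ 1 + S := by rw [abs_of_pos hlam0]; linarith
  have by' : ∀ r, |y r| ≤ |p r| + |q r| := fun r => by
    refine le_of_mul_le_mul_left ?_ hDpos
    have h1 := hcomb (-(1 + S)) lam (p r) (q r) (by rw [abs_neg, hSabs]) hlabs
    have h2 : |D| * |y r| = |-(1 + S) * p r + lam * q r| := by
      rw [← abs_mul, ey]
      congr 1
      ring
    rwa [← abs_of_pos hDpos, h2, abs_of_pos hDpos]
  have bφ' : ∀ r, |φ r| ≤ |p r| + |q r| := fun r => by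
    refine le_of_mul_le_mul_left ?_ hDpos
    have h1 := hcomb lam (1 + S) (p r) (q r) hlabs hSabs.le
    have h2 : |D| * |φ r| = |lam * p r + (1 + S) * q r| := by
      rw [← abs_mul, eφ]
      congr 1
      ring
    rwa [← abs_of_pos hDpos, h2, abs_of_pos hDpos]
  have hrem : ∀ a b r, |a| ≤ 1 + S → |b| ≤ 1 + S → R' ≤ r →
      |2 * (a * ((potential₁ ρ r - 1 / 8) * y r) + b * ((potential₂ ρ r - 17 / 8) * φ r))|
        ≤ 4 * D * C * Real.exp (-r) * (|p r| + |q r|) := by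
    intro a b r ha hb hr
    obtain ⟨h1, h2⟩ := hpot r hr
    have he := Real.exp_pos (-r)
    rw [abs_mul, abs_two]
    have h3 := hcomb a b ((potential₁ ρ r - 1 / 8) * y r) ((potential₂ ρ r - 17 / 8) * φ r) ha hb
    have h4 : |(potential₁ ρ r - 1 / 8) * y r| ≤ C * Real.exp (-r) * (|p r| + |q r|) := by
      rw [abs_mul]
      gcongr
      exact by' r
    have h5 : |(potential₂ ρ r - 17 / 8) * φ r| ≤ C * Real.exp (-r) * (|p r| + |q r|) := by
      rw [abs_mul]
      gcongr
      exact bφ' r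
    nlinarith
  have hpos : ∀ r, max R R' ≤ r → 0 < r := fun r hr => by
    have := (le_max_right R R').trans hr
    linarith
  obtain ⟨r₀, hr₀, hp0, hp1, hq1⟩ := exists_dominated_point (p := p) (p₁ := p₁) (q := q) (q₁ := q₁)
    (hp := fun r => 2 * (-(1 + S) * ((potential₁ ρ r - 1 / 8) * y r)
      + lam * ((potential₂ ρ r - 17 / 8) * φ r)))
    (hq := fun r => 2 * (lam * ((potential₁ ρ r - 1 / 8) * y r)
      + (1 + S) * ((potential₂ ρ r - 17 / 8) * φ r)))
    (w := 2 * (S - 9 / 8)) (k := k) (C := 4 * D * C) (R := max R R') (θ := θ)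
    (by linarith) (by linarith) (by positivity) hθpos
    (fun r hr => ((h.hφ r (hpos r hr)).const_mul lam).sub ((h.hy r (hpos r hr)).const_mul (1 + S)))
    (fun r hr => (((h.hφ₁ r (hpos r hr)).const_mul lam).sub
      ((h.hy₁ r (hpos r hr)).const_mul (1 + S))).congr_deriv
        (by simp only [hp]; linear_combination (-2 * y r) * hSsq))
    (fun r hr => ((h.hy r (hpos r hr)).const_mul lam).add ((h.hφ r (hpos r hr)).const_mul (1 + S)))
    (fun r hr => (((h.hy₁ r (hpos r hr)).const_mul lam).add
      ((h.hφ₁ r (hpos r hr)).const_mul (1 + S))).congr_deriv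
        (by simp only [hq]; rw [hksq]; linear_combination (-2 * φ r) * hSsq))
    (fun r hr => hrem _ _ r (by rw [abs_neg, hSabs]) hlabs ((le_max_right _ _).trans hr))
    (fun r hr => hrem _ _ r hlabs hSabs.le ((le_max_right _ _).trans hr))
    (by simpa using (φ0.const_mul lam).sub (y0.const_mul (1 + S)))
    (by simpa using (φ0'.const_mul lam).sub (y0'.const_mul (1 + S)))
    (by simpa using (y0.const_mul lam).add (φ0.const_mul (1 + S)))
    (by simpa using (y0'.const_mul lam).add (φ0'.const_mul (1 + S)))
  have hr₀pos := hpos r₀ hr₀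
  -- Domination by `q` means that `q r₀ = 0` kills all four Cauchy data at `r₀`.
  by_cases hz : q r₀ = 0
  · left
    rw [hz, abs_zero, mul_zero] at hp0 hp1 hq1
    have z1 : p r₀ = 0 := abs_nonpos_iff.1 hp0
    have z2 : p₁ r₀ = 0 := abs_nonpos_iff.1 hp1
    have z3 : q₁ r₀ = 0 := by
      simpa using hq1
    have cancel : ∀ x, D * x = 0 → x = 0 := fun x hx =>
      (mul_eq_zero.1 hx).resolve_left hDpos.ne'
    exact h.eq_zero hρ hr₀pos (cancel _ (by rw [ey, hz, z1]; ring))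
      (cancel _ (by rw [ey₁, z2, z3]; ring)) (cancel _ (by rw [eφ, hz, z1]; ring))
      (cancel _ (by rw [eφ₁, z2, z3]; ring))
  · right
    obtain ⟨σ, hσ, hσq⟩ : ∃ σ : ℝ, (σ = 1 ∨ σ = -1) ∧ σ * q r₀ = |q r₀| := by
      rcases lt_or_gt_of_ne hz with hneg | hpos'
      · exact ⟨-1, Or.inr rfl, by rw [abs_of_neg hneg]; ring⟩
      · exact ⟨1, Or.inl rfl, by rw [abs_of_pos hpos', one_mul]⟩
    have hσabs : ∀ x, |σ * x| = |x| := fun x => by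
      rcases hσ with rfl | rfl <;> simp
    have hQ : 0 < σ * q r₀ := hσq ▸ abs_pos.2 hz
    rw [← hσq, ← hσabs, abs_le] at hp0 hp1 hq1
    set Q := σ * q r₀ with hQdef
    have hkQ : σ * (q₁ r₀ + k * q r₀) = σ * q₁ r₀ + k * Q := by rw [hQdef]; ring
    rw [hkQ] at hq1
    have hkQ2 : 2 * Q ≤ k * Q := by gcongr
    have hq1' : σ * q₁ r₀ ≤ -2 * Q + θ * Q := by linarith [hq1.2]
    have hθQ : θ * Q ≤ 1 / 4 * Q := by gcongr
    have hSθQ : (1 + S) * (θ * Q) = lam / 4 * Q := by rw [← mul_assoc, hθS]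
    have hlQ : 0 < lam * Q := mul_pos hlam0 hQ
    have hSQ : lam * Q ≤ (1 + S) * Q := by gcongr; linarith
    have hlθQ : lam * (θ * Q) ≤ lam * (1 / 4 * Q) := by gcongr
    have hS1 : 0 ≤ 1 + S := by linarith
    have a1 := mul_le_mul_of_nonneg_left hp0.1 hS1
    have a2 := mul_le_mul_of_nonneg_left hp0.2 hS1
    have a3 := mul_le_mul_of_nonneg_left hp1.1 hS1
    have b1 := mul_le_mul_of_nonneg_left hp0.1 hlam0.le
    have b2 := mul_le_mul_of_nonneg_left hp0.2 hlam0.le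
    have b3 := mul_le_mul_of_nonneg_left hp1.2 hlam0.le
    have c1 := mul_le_mul_of_nonneg_left hq1' hlam0.le
    have c2 := mul_le_mul_of_nonneg_left hq1' hS1
    have Ey : D * (σ * y r₀) = lam * Q - (1 + S) * (σ * p r₀) := by
      linear_combination σ * ey r₀
    have Eφ : D * (σ * φ r₀) = (1 + S) * Q + lam * (σ * p r₀) := by
      linear_combination σ * eφ r₀
    have Ey₁ : D * (σ * y₁ r₀) = lam * (σ * q₁ r₀) - (1 + S) * (σ * p₁ r₀) := by
      linear_combination σ * ey₁ r₀
    have Eφ₁ : D * (σ * φ₁ r₀) = (1 + S) * (σ * q₁ r₀) + lam * (σ * p₁ r₀) := by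
      linear_combination σ * eφ₁ r₀
    refine ⟨σ, r₀, (le_max_left _ _).trans hr₀, hr₀pos, hσ, pos_of_mul_pos_right (a := D) ?_ hDpos.le,
      pos_of_mul_pos_right (a := D) ?_ hDpos.le, le_of_mul_le_mul_left ?_ hDpos,
      le_of_mul_le_mul_left ?_ hDpos⟩
    · rw [Ey]; linarith
    · rw [Eφ]; linarith
    · rw [mul_neg, Ey, Ey₁]; linarith
    · rw [mul_neg, Eφ, Eφ₁]; linarith

/-- Positivity propagates to the left, with a strictly negative Wronskian. -/
theorem pos_left (hρ : IsVortexProfile ρ) (h : IsSolution ρ lam y y₁ φ φ₁) (hlam : 0 ≤ lam)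
    {r₀ : ℝ} (hy0 : 0 < y r₀) (hφ0 : 0 < φ r₀)
    (hWy : y₁ r₀ * zeroMode ρ r₀ - y r₀ * zeroModeDeriv ρ r₀ ≤ 0)
    (hWφ : φ₁ r₀ * zeroMode ρ r₀ - φ r₀ * zeroModeDeriv ρ r₀ ≤ 0) :
    ∀ r ∈ Ioc 0 r₀, 0 < y r ∧ y₁ r * zeroMode ρ r - y r * zeroModeDeriv ρ r
      ≤ y₁ r₀ * zeroMode ρ r₀ - y r₀ * zeroModeDeriv ρ r₀ := by
  have step : ∀ a ∈ Ioc 0 r₀, (∀ r ∈ Ioo a r₀, 0 ≤ y r ∧ 0 ≤ φ r) → (0 < y a ∧ 0 < φ a) ∧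
      y₁ a * zeroMode ρ a - y a * zeroModeDeriv ρ a
        ≤ y₁ r₀ * zeroMode ρ r₀ - y r₀ * zeroModeDeriv ρ r₀ := by
    intro a ha hnn
    have hsub : ∀ r ∈ Icc a r₀, 0 < r := fun r hr => ha.1.trans_le hr.1
    have h1 := pos_of_wronskian_nonpos ha.2 (fun r hr => h.hy r (hsub r hr))
      (fun r hr => h.hy₁ r (hsub r hr)) (fun r hr => hρ.hasDerivAt_zeroMode (hsub r hr))
      (fun r hr => hρ.hasDerivAt_zeroModeDeriv (hsub r hr))
      (fun r hr => hρ.zeroMode_pos (hsub r hr)) (fun r hr => ?_) hy0 hWy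
    · have h2 := pos_of_wronskian_nonpos ha.2 (fun r hr => h.hφ r (hsub r hr))
        (fun r hr => h.hφ₁ r (hsub r hr)) (fun r hr => hρ.hasDerivAt_zeroMode (hsub r hr))
        (fun r hr => hρ.hasDerivAt_zeroModeDeriv (hsub r hr))
        (fun r hr => hρ.zeroMode_pos (hsub r hr)) (fun r hr => ?_) hφ0 hWφ
      · exact ⟨⟨h1.1, h2.1⟩, h1.2⟩
      · have hf := (hρ.zeroMode_pos (hsub r (Ioo_subset_Icc_self hr))).le
        obtain ⟨n1, n2⟩ := hnn r hr
        -- The potential of `𝔏₂` exceeds that of `𝔏₁` by `2 ρ²`, so the zero mode of `𝔏₁` serves as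
        -- comparison function for `φ` too.
        have : 2 * (potential₂ ρ r * φ r + lam * y r) * zeroMode ρ r
            - φ r * (2 * potential₁ ρ r * zeroMode ρ r)
            = 2 * (2 * ρ r ^ 2 * φ r + lam * y r) * zeroMode ρ r := by
          simp only [potential₁, potential₂]
          ring
        rw [this]
        positivity
    · have hf := (hρ.zeroMode_pos (hsub r (Ioo_subset_Icc_self hr))).le
      obtain ⟨n1, n2⟩ := hnn r hr
      have : 2 * (potential₁ ρ r * y r + lam * φ r) * zeroMode ρ r
          - y r * (2 * potential₁ ρ r * zeroMode ρ r) = 2 * lam * φ r * zeroMode ρ r := by ring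
      rw [this]
      positivity
  have allpos : ∀ x ∈ Ioc 0 r₀, 0 ≤ y x ∧ 0 ≤ φ x := by
    intro x hx
    by_contra hneg
    have hsub : Icc x r₀ ⊆ Ioi 0 := fun r hr => hx.1.trans_le hr.1
    have cmin : ContinuousOn (fun r => min (y r) (φ r)) (Icc x r₀) := fun r hr =>
      ContinuousAt.continuousWithinAt
        ((h.hy r (hsub hr)).continuousAt.min (h.hφ r (hsub hr)).continuousAt)
    have hcl : IsCompact (Icc x r₀ ∩ (fun r => min (y r) (φ r)) ⁻¹' Iic 0) :=
      isCompact_Icc.of_isClosed_subset (cmin.preimage_isClosed_of_isClosed isClosed_Icc isClosed_Iic)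
        inter_subset_left
    have hx0 : min (y x) (φ x) ≤ 0 := by
      by_contra! hc
      exact hneg ⟨(lt_min_iff.1 hc).1.le, (lt_min_iff.1 hc).2.le⟩
    -- Rightmost failure of positivity: both functions are positive between `a` and `r₀`, so `step`
    -- gives positivity at `a` itself.
    obtain ⟨a, ⟨ha1, ha2⟩, hamax⟩ := hcl.exists_isGreatest ⟨x, ⟨le_rfl, hx.2⟩, hx0⟩
    have hstep := step a ⟨hx.1.trans_le ha1.1, ha1.2⟩ fun r hr => by
      have hr' : 0 < min (y r) (φ r) := by
        by_contra! hc
        exact absurd (hamax ⟨⟨ha1.1.trans hr.1.le, hr.2.le⟩, hc⟩) (not_le.2 hr.1)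
      exact ⟨(lt_min_iff.1 hr').1.le, (lt_min_iff.1 hr').2.le⟩
    exact absurd (lt_min hstep.1.1 hstep.1.2) (not_lt.2 ha2)
  intro r hr
  have := step r hr fun t ht => allpos t ⟨hr.1.trans ht.1, ht.2.le⟩
  exact ⟨this.1.1, this.2⟩

end IsSolution

/-! ### Failure of square integrability at the origin. -/

theorem sinh_le_two_mul {r : ℝ} (h0 : 0 ≤ r) (h1 : r ≤ 1) : Real.sinh r ≤ 2 * r := by
  have h2 := (abs_le.1 (Real.abs_exp_sub_one_sub_id_le (x := r) (by rwa [abs_of_nonneg h0]))).2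
  have h3 := Real.add_one_le_exp (-r)
  rw [Real.sinh_eq]
  nlinarith

/-- A function whose Wronskian with the zero mode stays negative is not square integrable
at the origin. -/
theorem not_sq_integrable_of_wronskian {ρ y y₁ : ℝ → ℝ} (hρ : IsVortexProfile ρ)
    (hy : ∀ r, 0 < r → HasDerivAt y (y₁ r) r) {r₀ c : ℝ} (hr₀ : 0 < r₀) (hc : 0 < c)
    (hpos : ∀ r ∈ Ioc 0 r₀, 0 < y r)
    (hW : ∀ r ∈ Ioc 0 r₀, y₁ r * zeroMode ρ r - y r * zeroModeDeriv ρ r ≤ -c) :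
    ¬ IntegrableOn (fun r => y r ^ 2) (Ioi 0) := by
  intro hint
  obtain ⟨r₁, κ, K, hr₁, hκ, hK, hbd⟩ := hρ.exists_sinh_bounds
  set b := min r₁ r₀ with hb
  have hb0 : 0 < b := lt_min hr₁ hr₀
  have hsb : 0 < Real.sinh b := Real.sinh_pos_iff.2 hb0
  -- Since `f² ≤ K² sinh³`, `(y/f)' ≤ -c / (K² sinh³)`; this `A` is such that `(A / sinh²)' = -2 A
  -- cosh / sinh³` is no more negative on `(0, b]`.
  set A := c / (2 * K ^ 2 * Real.cosh b) with hA
  have hcb := Real.cosh_pos b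
  have hApos : 0 < A := by positivity
  have hAeq : 2 * A * Real.cosh b * K ^ 2 = c := by rw [hA]; field_simp
  clear_value A
  have hd : ∀ r, 0 < r → HasDerivAt (fun r => y r / zeroMode ρ r - A / Real.sinh r ^ 2)
      ((y₁ r * zeroMode ρ r - y r * zeroModeDeriv ρ r) / zeroMode ρ r ^ 2
        + 2 * A * Real.cosh r / Real.sinh r ^ 3) r := by
    intro r hr
    have hs : 0 < Real.sinh r := Real.sinh_pos_iff.2 hr
    refine (((hy r hr).div (hρ.hasDerivAt_zeroMode hr) (hρ.zeroMode_pos hr).ne').sub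
      ((hasDerivAt_const r A).div ((Real.hasDerivAt_sinh r).pow 2) (pow_pos hs 2).ne')).congr_deriv ?_
    simp only [Pi.pow_apply]
    push_cast
    field_simp
    ring
  have hanti : AntitoneOn (fun r => y r / zeroMode ρ r - A / Real.sinh r ^ 2) (Ioc 0 b) := by
    refine antitoneOn_of_hasDerivWithinAt_nonpos (convex_Ioc 0 b)
      (fun r hr => (hd r hr.1).continuousAt.continuousWithinAt)
      (fun r hr => (hd r (interior_subset hr).1).hasDerivWithinAt) fun r hr => ?_
    obtain ⟨hr0, hrb⟩ := interior_subset hr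
    have hs : 0 < Real.sinh r := Real.sinh_pos_iff.2 hr0
    have hf := hρ.zeroMode_pos hr0
    have h1 := hW r ⟨hr0, hrb.trans (min_le_right _ _)⟩
    have h2 := (hbd r ⟨hr0, hrb.trans (min_le_left _ _)⟩).2
    have hρ0 := hρ.pos hr0
    have h3 : zeroMode ρ r ^ 2 ≤ K ^ 2 * Real.sinh r ^ 3 := by
      rw [zeroMode, mul_pow, Real.sq_sqrt hs.le]
      calc Real.sinh r * ρ r ^ 2 ≤ Real.sinh r * (K * Real.sinh r) ^ 2 := by gcongr
        _ = _ := by ring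
    have h4 : (y₁ r * zeroMode ρ r - y r * zeroModeDeriv ρ r) / zeroMode ρ r ^ 2
        ≤ -(c / (K ^ 2 * Real.sinh r ^ 3)) := by
      calc _ ≤ -c / zeroMode ρ r ^ 2 := by gcongr
        _ = -(c / zeroMode ρ r ^ 2) := by ring
        _ ≤ _ := by gcongr
    have hcosh : Real.cosh r ≤ Real.cosh b := by
      rw [Real.cosh_le_cosh, abs_of_pos hr0, abs_of_pos hb0]
      exact hrb
    have h5 : 2 * A * Real.cosh r / Real.sinh r ^ 3 ≤ c / (K ^ 2 * Real.sinh r ^ 3) := by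
      calc _ ≤ 2 * A * Real.cosh b / Real.sinh r ^ 3 := by gcongr
        _ = _ := by rw [← hAeq]; field_simp
    linarith
  have hsinh0 : Tendsto (fun r => Real.sinh r ^ 2) (𝓝[>] 0) (𝓝 0) := by
    have h0 : Continuous fun r => Real.sinh r ^ 2 := Real.continuous_sinh.pow 2
    have := (h0.tendsto 0).mono_left (nhdsWithin_le_nhds (s := Ioi (0 : ℝ)))
    simpa using this
  obtain ⟨δ, hδ, hsub⟩ := mem_nhdsGT_iff_exists_Ioc_subset.1
    ((hsinh0.eventually (gt_mem_nhds (show 0 < Real.sinh b ^ 2 / 2 by positivity))).and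
      (Ioc_mem_nhdsGT (lt_min hb0 one_pos)))
  have hδ0 : 0 < δ := hδ
  -- On `(0, δ]` the value of `A / sinh²` at `b` is at most half of that at `r`, so `y/f ≥ A / (2
  -- sinh²)`. With `f ≥ κ sinh^(3/2)` this gives `y² ≥ (κ A / 2)² / sinh r`, and `sinh r ≤ 2 r`
  -- accounts for the last factor `2`.
  have lower : ∀ r ∈ Ioc 0 δ, (κ * A / 2) ^ 2 / 2 * r⁻¹ ≤ y r ^ 2 := by
    intro r hr
    obtain ⟨hlt, hr0, hrmin⟩ := hsub hr
    have hrb : r ≤ b := hrmin.trans (min_le_left _ _)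
    have hs : 0 < Real.sinh r := Real.sinh_pos_iff.2 hr0
    have hg : 0 < √(Real.sinh r) := Real.sqrt_pos.2 hs
    have hf := hρ.zeroMode_pos hr0
    have h1 := hanti ⟨hr0, hrb⟩ ⟨hb0, le_rfl⟩ hrb
    have h2 : 0 < y b / zeroMode ρ b := div_pos (hpos b ⟨hb0, min_le_right _ _⟩)
      (hρ.zeroMode_pos hb0)
    have h3 : A / Real.sinh b ^ 2 ≤ A / Real.sinh r ^ 2 / 2 := by
      rw [div_div]
      gcongr
      linarith
    have h4 : A / Real.sinh r ^ 2 / 2 ≤ y r / zeroMode ρ r := by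
      simp only at h1
      linarith
    rw [le_div_iff₀ hf] at h4
    have h5 := (hbd r ⟨hr0, hrb.trans (min_le_left _ _)⟩).1
    have h6 : √(Real.sinh r) * (κ * Real.sinh r) ≤ zeroMode ρ r := by
      rw [zeroMode]
      gcongr
    have h7 : A / Real.sinh r ^ 2 / 2 * (√(Real.sinh r) * (κ * Real.sinh r)) ≤ y r :=
      le_trans (by gcongr) h4
    have h8 : (A / Real.sinh r ^ 2 / 2 * (√(Real.sinh r) * (κ * Real.sinh r))) ^ 2
        = (κ * A / 2) ^ 2 * (Real.sinh r)⁻¹ := by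
      rw [mul_pow, mul_pow (√(Real.sinh r)), Real.sq_sqrt hs.le]
      field_simp
    have h9 : (2 * r)⁻¹ ≤ (Real.sinh r)⁻¹ :=
      inv_anti₀ hs (sinh_le_two_mul hr0.le (hrmin.trans (min_le_right _ _)))
    calc (κ * A / 2) ^ 2 / 2 * r⁻¹ = (κ * A / 2) ^ 2 * (2 * r)⁻¹ := by rw [mul_inv]; ring
      _ ≤ (κ * A / 2) ^ 2 * (Real.sinh r)⁻¹ := by gcongr
      _ = _ := h8.symm
      _ ≤ _ := by gcongr
  have hcpos : 0 < (κ * A / 2) ^ 2 / 2 := by positivity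
  have hI : IntegrableOn (fun r => (κ * A / 2) ^ 2 / 2 * r⁻¹) (Ioc 0 δ) := by
    refine (hint.mono_set Ioc_subset_Ioi_self).mono' (by fun_prop)
      ((ae_restrict_iff' measurableSet_Ioc).2 (ae_of_all _ fun r hr => ?_))
    have : 0 ≤ r⁻¹ := inv_nonneg.2 hr.1.le
    rw [Real.norm_eq_abs, abs_of_nonneg (by positivity)]
    exact lower r hr
  have hI' : IntervalIntegrable (fun r : ℝ => r⁻¹) volume 0 δ := by
    rw [intervalIntegrable_iff_integrableOn_Ioc_of_le hδ0.le]
    refine IntegrableOn.congr_fun (hI.const_mul ((κ * A / 2) ^ 2 / 2)⁻¹) (fun r _ => ?_)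
      measurableSet_Ioc
    rw [← mul_assoc, inv_mul_cancel₀ hcpos.ne', one_mul]
  rcases intervalIntegrable_inv_iff.1 hI' with h0 | h0
  · exact hδ0.ne h0
  · exact h0 left_mem_uIcc

/-- Beyond the threshold, square-integrable solutions vanish. -/
theorem IsSolution.eq_zero_of_sq_integrable {ρ y y₁ φ φ₁ : ℝ → ℝ} {lam : ℝ}
    (hρ : IsVortexProfile ρ) (h : IsSolution ρ lam y y₁ φ φ₁) (hlam : √17 / 8 ≤ lam)
    (iy : IntegrableOn (fun r => y r ^ 2) (Ioi 0))
    (iφ : IntegrableOn (fun r => φ r ^ 2) (Ioi 0)) :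
    ∀ r, 0 < r → y r = 0 ∧ φ r = 0 := by
  have hlam0 : 0 ≤ lam := le_trans (by positivity) hlam
  obtain ⟨R, hR⟩ := eventually_atTop.1 hρ.eventually_zeroModeDeriv_add_pos
  have main : ∀ {y y₁ φ φ₁ : ℝ → ℝ}, IsSolution ρ lam y y₁ φ φ₁ →
      IntegrableOn (fun r => y r ^ 2) (Ioi 0) → ∀ r, R ≤ r → 0 < r → 0 < y r → 0 < φ r →
      y₁ r ≤ -y r → φ₁ r ≤ -φ r → False := by
    intro y y₁ φ φ₁ h iy r hrR hr hy0 hφ0 hy1 hφ1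
    have hf := hρ.zeroMode_pos hr
    have hWneg : ∀ u u₁ : ℝ, 0 < u → u₁ ≤ -u →
        u₁ * zeroMode ρ r - u * zeroModeDeriv ρ r < 0 := by
      intro u u₁ hu hu₁
      have h1 := mul_pos hu (hR r hrR)
      have h2 := mul_le_mul_of_nonneg_right hu₁ hf.le
      linarith
    have hleft := h.pos_left hρ hlam0 hy0 hφ0 (hWneg _ _ hy0 hy1).le (hWneg _ _ hφ0 hφ1).le
    exact not_sq_integrable_of_wronskian hρ h.hy hr (neg_pos.2 (hWneg _ _ hy0 hy1))
      (fun t ht => (hleft t ht).1) (fun t ht => by rw [neg_neg]; exact (hleft t ht).2) iy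
  rcases h.eq_zero_or_exists_signs hρ hlam iy iφ R with hz | ⟨σ, r, hrR, hr, hσ, s1, s2, s3, s4⟩
  · exact hz
  · exfalso
    rcases hσ with rfl | rfl
    · simp only [one_mul] at s1 s2 s3 s4
      exact main h iy r hrR hr s1 s2 s3 s4
    · simp only [neg_one_mul] at s1 s2 s3 s4
      exact main h.neg (by simpa using iy) r hrR hr s1 s2 s3 s4

/-! ### From `L²` eigenvectors to real classical solutions. -/

/-- If the weak second derivative has a continuous representative, it is the classical one. -/
theorem HasSecondDeriv.hasDerivAt_of_ae_eq {u u₁ u₂ G : ℝ → ℂ} (hu : HasSecondDeriv u u₁ u₂)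
    (hG : ContinuousOn G (Ioi 0)) (h : u₂ =ᵐ[halfLine] G) (r : ℝ) (hr : 0 < r) :
    HasDerivAt u₁ (G r) r := by
  have hae : ∀ᵐ t, t ∈ Ioi (0 : ℝ) → u₂ t = G t := (ae_restrict_iff' measurableSet_Ioi).1 h
  have hint : ∀ x, 0 < x → u₁ x = u₁ r + ∫ t in r..x, G t := by
    intro x hx
    have h1 : ∫ t in r..x, u₂ t = ∫ t in r..x, G t := by
      refine intervalIntegral.integral_congr_ae ?_
      filter_upwards [hae] with t ht hmem
      exact ht ((lt_min hr hx).trans hmem.1)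
    rw [← h1, hu.integral_eq r x hr hx]
    ring
  have hd : HasDerivAt (fun x => ∫ t in r..x, G t) (G r) r :=
    intervalIntegral.integral_hasDerivAt_right (by simp)
      (hG.stronglyMeasurableAtFilter isOpen_Ioi r hr) (hG.continuousAt (Ioi_mem_nhds hr))
  refine (hd.const_add (u₁ r)).congr_of_eventuallyEq ?_
  filter_upwards [Ioi_mem_nhds hr] with x hx using hint x hx

/-- Beyond the threshold, complex square-integrable solutions vanish. -/
theorem complex_eq_zero_of_memLp {ρ : ℝ → ℝ} {y y₁ φ φ₁ : ℝ → ℂ} {lam : ℝ}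
    (hρ : IsVortexProfile ρ) (hlam : √17 / 8 ≤ lam)
    (hy : ∀ r, 0 < r → HasDerivAt y (y₁ r) r)
    (hy₁ : ∀ r, 0 < r → HasDerivAt y₁ (2 * ((potential₁ ρ r : ℂ) * y r + lam * φ r)) r)
    (hφ : ∀ r, 0 < r → HasDerivAt φ (φ₁ r) r)
    (hφ₁ : ∀ r, 0 < r → HasDerivAt φ₁ (2 * ((potential₂ ρ r : ℂ) * φ r + lam * y r)) r)
    (my : MemLp y 2 halfLine) (mφ : MemLp φ 2 halfLine) :
    ∀ r, 0 < r → y r = 0 ∧ φ r = 0 := by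
  have main : ∀ l : ℂ →L[ℝ] ℝ, ∀ r, 0 < r → l (y r) = 0 ∧ l (φ r) = 0 := by
    intro l
    have hd : ∀ {f : ℝ → ℂ} {f' : ℂ} {r : ℝ}, HasDerivAt f f' r →
        HasDerivAt (fun t => l (f t)) (l f') r := fun hf => l.hasFDerivAt.comp_hasDerivAt _ hf
    have hl : ∀ (V c : ℝ) (z w : ℂ), l (2 * ((V : ℂ) * z + c * w)) = 2 * (V * l z + c * l w) := by
      intro V c z w
      have : 2 * ((V : ℂ) * z + c * w) = (2 : ℝ) • (V • z + c • w) := by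
        simp only [Complex.real_smul]
        push_cast
        ring
      rw [this, map_smul, map_add, map_smul, map_smul]
      simp only [smul_eq_mul]
    have hsol : IsSolution ρ lam (fun r => l (y r)) (fun r => l (y₁ r)) (fun r => l (φ r))
        (fun r => l (φ₁ r)) :=
      { hy := fun r hr => hd (hy r hr)
        hy₁ := fun r hr => (hd (hy₁ r hr)).congr_deriv (hl _ _ _ _)
        hφ := fun r hr => hd (hφ r hr)
        hφ₁ := fun r hr => (hd (hφ₁ r hr)).congr_deriv (hl _ _ _ _) }
    exact hsol.eq_zero_of_sq_integrable hρ hlam (l.comp_memLp' my).integrable_sq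
      (l.comp_memLp' mφ).integrable_sq
  intro r hr
  have h1 := main Complex.reCLM r hr
  have h2 := main Complex.imCLM r hr
  exact ⟨Complex.ext h1.1 h2.1, Complex.ext h1.2 h2.2⟩

/-- Beyond the threshold, `𝔏₁ ψ = -i lam φ` and `𝔏₂ φ = i lam ψ` only for `φ = ψ = 0`. -/
theorem eq_zero_of_mem_schrodingerGraph {ρ : ℝ → ℝ} {lam : ℝ} (hρ : IsVortexProfile ρ)
    (hlam : √17 / 8 ≤ |lam|) {φ ψ : L2}
    (h₁ : (ψ, -(Complex.I * lam) • φ) ∈ schrodingerGraph (potential₁ ρ))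
    (h₂ : (φ, (Complex.I * lam) • ψ) ∈ schrodingerGraph (potential₂ ρ)) : φ = 0 ∧ ψ = 0 := by
  obtain ⟨v, v₁, v₂, hv, hψv, hv₂⟩ := h₁
  obtain ⟨u, u₁, u₂, hu, hφu, hu₂⟩ := h₂
  simp only at hψv hv₂ hφu hu₂
  have cv : ContinuousOn v (Ioi 0) := fun r hr => (hv.hasDerivAt r hr).continuousAt.continuousWithinAt
  have cu : ContinuousOn u (Ioi 0) := fun r hr => (hu.hasDerivAt r hr).continuousAt.continuousWithinAt
  -- The eigenvalue equation expresses `v₂` almost everywhere through the continuous functions `u`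
  -- and `v`, so the weak solution is classical.
  have dv := hv.hasDerivAt_of_ae_eq
    (G := fun r => 2 * ((potential₁ ρ r : ℂ) * v r + Complex.I * lam * u r))
    (continuousOn_const.mul (((Complex.continuous_ofReal.comp_continuousOn
      hρ.continuousOn_potential₁).mul cv).add (continuousOn_const.mul cu))) (by
      filter_upwards [hv₂, hφu, Lp.coeFn_smul (-(Complex.I * lam)) φ] with r e1 e2 e3
      rw [e3, Pi.smul_apply, e2, smul_eq_mul] at e1
      linear_combination 2 * e1)
  have du := hu.hasDerivAt_of_ae_eq
    (G := fun r => 2 * ((potential₂ ρ r : ℂ) * u r - Complex.I * lam * v r))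
    (continuousOn_const.mul (((Complex.continuous_ofReal.comp_continuousOn
      hρ.continuousOn_potential₂).mul cu).sub (continuousOn_const.mul cv))) (by
      filter_upwards [hu₂, hψv, Lp.coeFn_smul (Complex.I * lam) ψ] with r e1 e2 e3
      rw [e3, Pi.smul_apply, e2, smul_eq_mul] at e1
      linear_combination 2 * e1)
  have mv : MemLp v 2 halfLine := (memLp_congr_ae hψv).1 (Lp.memLp ψ)
  have mu : MemLp u 2 halfLine := (memLp_congr_ae hφu).1 (Lp.memLp φ)
  obtain ⟨σ, hσ, hσl⟩ : ∃ σ : ℝ, σ * σ = 1 ∧ |lam| = σ * lam := by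
    rcases abs_cases lam with ⟨h, -⟩ | ⟨h, -⟩
    · exact ⟨1, by norm_num, by rw [h, one_mul]⟩
    · exact ⟨-1, by norm_num, by rw [h, neg_one_mul]⟩
  have hσc : (σ : ℂ) * σ = 1 := by exact_mod_cast hσ
  -- With `σ` the sign of `lam`, the rotation `y = -iσ v` turns both couplings into the real
  -- constant `|lam|`.
  have hz := complex_eq_zero_of_memLp (y := fun r => -(σ * Complex.I) * v r)
    (y₁ := fun r => -(σ * Complex.I) * v₁ r) (φ := u) (φ₁ := u₁) hρ hlam
    (fun r hr => (hv.hasDerivAt r hr).const_mul _)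
    (fun r hr => ((dv r hr).const_mul _).congr_deriv (by
      rw [hσl]
      push_cast
      linear_combination (-2 * σ * lam * u r) * Complex.I_sq))
    hu.hasDerivAt
    (fun r hr => (du r hr).congr_deriv (by
      rw [hσl]
      push_cast
      linear_combination (2 * Complex.I * lam * v r) * hσc))
    (mv.const_mul _) mu
  have hσI : -((σ : ℂ) * Complex.I) ≠ 0 := by
    refine neg_ne_zero.2 (mul_ne_zero ?_ Complex.I_ne_zero)
    intro h0
    simp [h0] at hσc
  have zero_of : ∀ (χ : L2) (w : ℝ → ℂ), χ =ᵐ[halfLine] w → (∀ r, 0 < r → w r = 0) → χ = 0 := by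
    intro χ w hχ hw
    refine Lp.ext (hχ.trans (EventuallyEq.trans ?_ (Lp.coeFn_zero ℂ 2 halfLine).symm))
    exact (ae_restrict_iff' measurableSet_Ioi).2 (ae_of_all _ hw)
  exact ⟨zero_of φ u hφu fun r hr => (hz r hr).2,
    zero_of ψ v hψv fun r hr => (mul_eq_zero.1 (hz r hr).1).resolve_left hσI⟩

end GrossPitaevskii

theorem lemma2p9 (ρ : ℝ → ℝ) (hρ : GrossPitaevskii.IsVortexProfile ρ) (lam : ℝ)
    (hlam : lam ∈ Set.Iic (-(Real.sqrt 17 / 8)) ∪ Set.Ici (Real.sqrt 17 / 8)) :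
    ¬ GrossPitaevskii.HasEigenvalue (Complex.I • GrossPitaevskii.linearizedGP ρ) (lam : ℂ) := by
  rintro ⟨⟨⟨φ, ψ⟩, hφ, hψ⟩, hne, heq⟩
  have habs : √17 / 8 ≤ |lam| := by
    rcases hlam with h | h
    · exact le_abs.2 (Or.inr (le_neg.1 h))
    · exact le_abs.2 (Or.inl h)
  have e1 : Complex.I • GrossPitaevskii.frakL₁ ρ ⟨ψ, hψ⟩ = (lam : ℂ) • φ := congrArg Prod.fst heq
  have e2 : Complex.I • -GrossPitaevskii.frakL₂ ρ ⟨φ, hφ⟩ = (lam : ℂ) • ψ := congrArg Prod.snd heq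
  have a1 : GrossPitaevskii.frakL₁ ρ ⟨ψ, hψ⟩ = -(Complex.I * lam) • φ := by
    rw [neg_smul, mul_smul, ← e1, smul_smul, Complex.I_mul_I, neg_one_smul, neg_neg]
  have a2 : GrossPitaevskii.frakL₂ ρ ⟨φ, hφ⟩ = (Complex.I * lam) • ψ := by
    rw [mul_smul, ← e2, smul_smul, Complex.I_mul_I, neg_one_smul, neg_neg]
  have g1 : (ψ, GrossPitaevskii.frakL₁ ρ ⟨ψ, hψ⟩) ∈
      GrossPitaevskii.schrodingerGraph (GrossPitaevskii.potential₁ ρ) :=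
    GrossPitaevskii.schrodinger_graph (GrossPitaevskii.potential₁ ρ) ▸
      LinearPMap.mem_graph (GrossPitaevskii.frakL₁ ρ) ⟨ψ, hψ⟩
  have g2 : (φ, GrossPitaevskii.frakL₂ ρ ⟨φ, hφ⟩) ∈
      GrossPitaevskii.schrodingerGraph (GrossPitaevskii.potential₂ ρ) :=
    GrossPitaevskii.schrodinger_graph (GrossPitaevskii.potential₂ ρ) ▸
      LinearPMap.mem_graph (GrossPitaevskii.frakL₂ ρ) ⟨φ, hφ⟩
  rw [a1] at g1
  rw [a2] at g2
  obtain ⟨rfl, rfl⟩ := GrossPitaevskii.eq_zero_of_mem_schrodingerGraph hρ habs g1 g2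
  exact hne rfl
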